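/- Let $(\Omega,\mu)$ be an arbitrary measure space, $\mathbb K\in\{\mathbb R,\mathbb C\}$, $p\in(1,\infty)$, and let $T$ be a positive $C_0$-semigroup on $L_p(\mu)=L_p(\mu;\mathbb K)$ with generator $A$. For bounded measurable $W\colon\Omega\to\mathbb R$ let $T_W$ be the $C_0$-semigroup generated by $A-W$, where $W$ acts by multiplication. A measurable function $V\ge0$ (respectively $V\le0$) is called $T$-admissible if the strong limit of $T_{V\wedge n}(t)$ (respectively of $T_{V\vee(-n)}(t)$) as $n\to\infty$ exists for all $t\ge0$ and defines a $C_0$-semigroup on $L_p(\mu)$. A measurable function $V\colon\Omega\to\mathbb R$ is called $T$-admissible if both $V^+=V\vee0$ and $-V^-=V\wedge 0$ are $T$-admissible, and then $T_V(t)$ denotes the strong limit of $T_{(V\wedge n)\vee(-n)}(t)$ as $n\to\infty$. For a bounded linear operator $B$ on $L_p(\mu)$ and $q,r\in[1,\infty]$ put $$\|B\|_{q\to r}:=\sup\{\|Bf\|_r : f\in L_p(\mu)\cap L_q(\mu),\ \|f\|_q\le1\}\in[0,\infty].$$ **Theorem.** Let $V\colon\Omega\to\mathbb R$ be $T$-admissible,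 let $t>0$ and $p_0,p_1,q_0,q_1\in[1,\infty]$, and assume that $\|T(t)\|_{p_0\to q_0}<\infty$ and $\|T_V(t)\|_{p_1\to q_1}<\infty$. Let $\theta\in(0,1)$ and define $p_\theta,q_\theta\in[1,\infty]$ by $$\frac1{p_\theta}=\frac{1-\theta}{p_0}+\frac{\theta}{p_1},\qquad \frac1{q_\theta}=\frac{1-\theta}{q_0}+\frac{\theta}{q_1}.$$ Then $\theta V$ is $T$-admissible, the strong limit $T_{\theta V}(s)$ of $T_{(\theta V\wedge n)\vee(-n)}(s)$ as $n\to\infty$ exists for all $s\ge0$, and $$\|T_{\theta V}(t)\|_{p_\theta\to q_\theta}\le\|T(t)\|_{p_0\to q_0}^{1-\theta}\,\|T_V(t)\|_{p_1\to q_1}^{\theta}.$$ -/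

import Mathlib

open Filter Topology MeasureTheory
open scoped NNReal ENNReal

noncomputable section

/-- A `C₀`-semigroup: a strongly continuous one-parameter semigroup of bounded operators. -/
structure IsC0Semigroup {𝕜 E : Type*} [RCLike 𝕜] [NormedAddCommGroup E] [NormedSpace 𝕜 E]
    (T : ℝ≥0 → E →L[𝕜] E) : Prop where
  map_zero : T 0 = ContinuousLinearMap.id 𝕜 E
  map_add : ∀ s t : ℝ≥0, T (s + t) = (T s).comp (T t)
  strong_continuous : ∀ x : E, Continuous fun t : ℝ≥0 => T t x

/-- `x` is in the domain of the generator `A` of `T`, and `A x = y`. -/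
def InGenerator {𝕜 E : Type*} [RCLike 𝕜] [NormedAddCommGroup E] [NormedSpace 𝕜 E]
    (T : ℝ≥0 → E →L[𝕜] E) (x y : E) : Prop :=
  Tendsto (fun h : ℝ≥0 => (((h : ℝ) : 𝕜))⁻¹ • (T h x - x)) (𝓝[>] 0) (𝓝 y)

/-- The family `S` converges strongly to `R`, at every time. -/
def StronglyTendsto {𝕜 E : Type*} [RCLike 𝕜] [NormedAddCommGroup E] [NormedSpace 𝕜 E]
    (S : ℕ → ℝ≥0 → E →L[𝕜] E) (R : ℝ≥0 → E →L[𝕜] E) : Prop :=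
  ∀ (t : ℝ≥0) (x : E), Tendsto (fun n : ℕ => S n t x) atTop (𝓝 (R t x))

/-- An operator on `L_p` is positive if it maps functions that are a.e. in `[0, ∞)` to
functions that are a.e. in `[0, ∞)`. -/
def IsPositiveLpOperator {Ω 𝕜 : Type*} [MeasurableSpace Ω] [RCLike 𝕜] {μ : Measure Ω}
    {p : ℝ≥0∞} [Fact (1 ≤ p)] (B : Lp 𝕜 p μ →L[𝕜] Lp 𝕜 p μ) : Prop :=
  ∀ f : Lp 𝕜 p μ, (∀ᵐ ω ∂μ, ∃ r : ℝ≥0, f ω = ((r : ℝ) : 𝕜)) →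
    ∀ᵐ ω ∂μ, ∃ r : ℝ≥0, (B f) ω = ((r : ℝ) : 𝕜)

/-- `S` is a `C₀`-semigroup with generator `A - W`, where `A` is the generator of `T` and `W`
acts by multiplication. -/
def IsGeneratedBySub {Ω 𝕜 : Type*} [MeasurableSpace Ω] [RCLike 𝕜] {μ : Measure Ω}
    {p : ℝ≥0∞} [Fact (1 ≤ p)] (T : ℝ≥0 → Lp 𝕜 p μ →L[𝕜] Lp 𝕜 p μ) (W : Ω → ℝ)
    (S : ℝ≥0 → Lp 𝕜 p μ →L[𝕜] Lp 𝕜 p μ) : Prop :=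
  IsC0Semigroup S ∧ ∀ f g : Lp 𝕜 p μ, InGenerator S f g ↔
    ∃ g₀ w : Lp 𝕜 p μ, InGenerator T f g₀ ∧ (w =ᵐ[μ] fun ω => (W ω : 𝕜) * f ω) ∧ g = g₀ - w

open Classical in
/-- For bounded measurable `W`: the `C₀`-semigroup `T_W` generated by `A - W`. For a
`C₀`-semigroup `T` and such `W` it exists and is unique; the value `0` is never used then. -/
def boundedPerturbation {Ω 𝕜 : Type*} [MeasurableSpace Ω] [RCLike 𝕜] {μ : Measure Ω}
    {p : ℝ≥0∞} [Fact (1 ≤ p)] (T : ℝ≥0 → Lp 𝕜 p μ →L[𝕜] Lp 𝕜 p μ) (W : Ω → ℝ) :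
    ℝ≥0 → Lp 𝕜 p μ →L[𝕜] Lp 𝕜 p μ :=
  if h : ∃ S, IsGeneratedBySub T W S then h.choose else 0

/-- `T`-admissibility of a potential `V ≥ 0`: the strong limit of `T_{V ∧ n}(t)` exists for all
`t` and is a `C₀`-semigroup. -/
def IsAdmissibleNonneg {Ω 𝕜 : Type*} [MeasurableSpace Ω] [RCLike 𝕜] {μ : Measure Ω}
    {p : ℝ≥0∞} [Fact (1 ≤ p)] (T : ℝ≥0 → Lp 𝕜 p μ →L[𝕜] Lp 𝕜 p μ) (V : Ω → ℝ) : Prop :=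
  ∃ S : ℝ≥0 → Lp 𝕜 p μ →L[𝕜] Lp 𝕜 p μ, IsC0Semigroup S ∧
    StronglyTendsto (fun n : ℕ => boundedPerturbation T fun ω => min (V ω) (n : ℝ)) S

/-- `T`-admissibility of a potential `V ≤ 0`: the strong limit of `T_{V ∨ (-n)}(t)` exists for
all `t` and is a `C₀`-semigroup. -/
def IsAdmissibleNonpos {Ω 𝕜 : Type*} [MeasurableSpace Ω] [RCLike 𝕜] {μ : Measure Ω}
    {p : ℝ≥0∞} [Fact (1 ≤ p)] (T : ℝ≥0 → Lp 𝕜 p μ →L[𝕜] Lp 𝕜 p μ) (V : Ω → ℝ) : Prop :=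
  ∃ S : ℝ≥0 → Lp 𝕜 p μ →L[𝕜] Lp 𝕜 p μ, IsC0Semigroup S ∧
    StronglyTendsto (fun n : ℕ => boundedPerturbation T fun ω => max (V ω) (-(n : ℝ))) S

/-- A measurable potential `V` is `T`-admissible if `V⁺` and `-V⁻` are. -/
def IsAdmissible {Ω 𝕜 : Type*} [MeasurableSpace Ω] [RCLike 𝕜] {μ : Measure Ω}
    {p : ℝ≥0∞} [Fact (1 ≤ p)] (T : ℝ≥0 → Lp 𝕜 p μ →L[𝕜] Lp 𝕜 p μ) (V : Ω → ℝ) : Prop :=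
  Measurable V ∧ IsAdmissibleNonneg T (fun ω => max (V ω) 0) ∧
    IsAdmissibleNonpos T (fun ω => -max (-V ω) 0)

/-- The semigroups `T_{(V ∧ n) ∨ (-n)}` of the truncated potentials. -/
def truncatedPerturbation {Ω 𝕜 : Type*} [MeasurableSpace Ω] [RCLike 𝕜] {μ : Measure Ω}
    {p : ℝ≥0∞} [Fact (1 ≤ p)] (T : ℝ≥0 → Lp 𝕜 p μ →L[𝕜] Lp 𝕜 p μ) (V : Ω → ℝ) (n : ℕ) :
    ℝ≥0 → Lp 𝕜 p μ →L[𝕜] Lp 𝕜 p μ :=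
  boundedPerturbation T fun ω => max (min (V ω) (n : ℝ)) (-(n : ℝ))

open Classical in
/-- The semigroup `T_V` of a `T`-admissible potential `V`: the strong limit of
`T_{(V ∧ n) ∨ (-n)}` (with the value `0` if there is no strong limit). -/
def perturbedSemigroup {Ω 𝕜 : Type*} [MeasurableSpace Ω] [RCLike 𝕜] {μ : Measure Ω}
    {p : ℝ≥0∞} [Fact (1 ≤ p)] (T : ℝ≥0 → Lp 𝕜 p μ →L[𝕜] Lp 𝕜 p μ) (V : Ω → ℝ) :
    ℝ≥0 → Lp 𝕜 p μ →L[𝕜] Lp 𝕜 p μ :=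
  if h : ∃ S, StronglyTendsto (truncatedPerturbation T V) S then h.choose else 0

/-- `‖B‖_{q → r} = sup {‖B f‖_r : f ∈ L_p ∩ L_q, ‖f‖_q ≤ 1}`, in `[0, ∞]`. -/
def opNormLp {Ω 𝕜 : Type*} [MeasurableSpace Ω] [RCLike 𝕜] {μ : Measure Ω}
    {p : ℝ≥0∞} [Fact (1 ≤ p)] (B : Lp 𝕜 p μ →L[𝕜] Lp 𝕜 p μ) (q r : ℝ≥0∞) : ℝ≥0∞ :=
  ⨆ (f : Lp 𝕜 p μ) (_ : eLpNorm f q μ ≤ 1), eLpNorm (B f) r μ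

/-- The exponent `r` in `[1, ∞]` with `1 / r = (1 - θ) / r₀ + θ / r₁`. -/
def interpExponent (θ : ℝ) (r₀ r₁ : ℝ≥0∞) : ℝ≥0∞ :=
  (ENNReal.ofReal (1 - θ) / r₀ + ENNReal.ofReal θ / r₁)⁻¹

end

/-! For a bounded potential $W$ the Trotter product formula represents $T_W(t)$ as the strong limit
of $(T(t/k)e^{-tW/k})^k$. Two facts about the factors drive the proof. A positive operator $B$
satisfies a pointwise Hölder inequality: $0\le h\le f^{1-\theta}g^\theta$ implies
$Bh\le(Bf)^{1-\theta}(Bg)^\theta$, because by Young's inequality the geometric mean is an infimum of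
linear combinations of $f$ and $g$. And $e^{-s\theta W}=1^{1-\theta}(e^{-sW})^\theta$. Iterating and
passing to the limit gives $T_{\theta W}(t)h\le(T(t)f)^{1-\theta}(T_W(t)g)^\theta$
(`GeomMeanLE.boundedPerturbation`), and a limit over truncations extends this to admissible $V$
(`GeomMeanLE.perturbedSemigroup`).

Taking $f=h^a$, $g=h^b$ with $a=p_\theta/p_0$, $b=p_\theta/p_1$ makes $f^{1-\theta}g^\theta=h$, and
Hölder's inequality for norms then yields the estimate, without complex interpolation
(`opNormLp_le_of_geomMeanLE`). Cutting $h$ off away from $0$ and $\infty$ keeps these powers in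
$L_p$; Fatou's lemma removes the cut-off.

Admissibility of $\theta V$ comes from order. The semigroups depend antitonically on the potential,
monotone order-bounded sequences in $L_p$ converge, and a squeeze between two $C_0$-semigroups keeps
strong continuity at $0$ (`exists_isC0Semigroup_limit`). For potentials of mixed sign,
`boundedPerturbation_sub_le` controls the negative cut-off uniformly in the positive one
(`IsAdmissible.exists_strong_limit`). -/

noncomputable section

set_option linter.unusedSectionVars false

/-! ### Growth bounds, joint continuity and rescaling of $C_0$-semigroups. -/

section C0Semigroup

variable {𝕜 E : Type*} [RCLike 𝕜] [NormedAddCommGroup E] [NormedSpace 𝕜 E]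

theorem IsC0Semigroup.exists_norm_le_exp [CompleteSpace E] {T : ℝ≥0 → E →L[𝕜] E}
    (hT : IsC0Semigroup T) :
    ∃ M ω : ℝ, 1 ≤ M ∧ 0 ≤ ω ∧ ∀ t : ℝ≥0, ‖T t‖ ≤ M * Real.exp (ω * t) := by
  obtain ⟨C, hC⟩ : ∃ C, ∀ t : Set.Icc (0 : ℝ≥0) 1, ‖T t‖ ≤ C := by
    refine banach_steinhaus fun x => ?_
    obtain ⟨C, hC⟩ := isCompact_Icc.exists_bound_of_continuousOn
      (hT.strong_continuous x).continuousOn (s := Set.Icc (0 : ℝ≥0) 1)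
    exact ⟨C, fun t => hC t t.2⟩
  set M : ℝ := max C 1
  have hM1 : 1 ≤ M := le_max_right _ _
  have hM0 : 0 ≤ M := zero_le_one.trans hM1
  have hM : ∀ t : ℝ≥0, t ≤ 1 → ‖T t‖ ≤ M := fun t ht =>
    (hC ⟨t, zero_le, ht⟩).trans (le_max_left _ _)
  -- Each unit of time beyond the first costs one more factor `M`; hence the growth rate `Real.log
  -- M`.
  have key : ∀ (n : ℕ) (t : ℝ≥0), t ≤ n + 1 → ‖T t‖ ≤ M * M ^ n := by
    intro n
    induction n with
    | zero => intro t ht; simpa using hM t (by simpa using ht)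
    | succ n ih =>
      intro t ht
      by_cases h1 : t ≤ 1
      · exact (hM t h1).trans (le_mul_of_one_le_right hM0 (one_le_pow₀ hM1))
      · push Not at h1
        have e : t = 1 + (t - 1) := (add_tsub_cancel_of_le h1.le).symm
        rw [e, hT.map_add]
        calc ‖(T 1).comp (T (t - 1))‖ ≤ ‖T 1‖ * ‖T (t - 1)‖ := ContinuousLinearMap.opNorm_comp_le _ _
          _ ≤ M * (M * M ^ n) := by
            gcongr
            · exact hM 1 le_rfl
            · exact ih _ (tsub_le_iff_right.2 (by push_cast at ht; exact ht))
          _ = _ := by ring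
  refine ⟨M, Real.log M, hM1, Real.log_nonneg hM1, fun t => ?_⟩
  refine (key ⌊t⌋₊ t (Nat.lt_floor_add_one t).le).trans ?_
  gcongr
  rw [← Real.rpow_natCast, Real.rpow_def_of_pos (by positivity)]
  gcongr
  · exact Real.log_nonneg hM1
  · exact_mod_cast Nat.floor_le (zero_le (a := t))

/-- Local boundedness upgrades strong continuity to joint continuity, which makes integrands such as
`T (t - s) (W (u s))` continuous. -/
theorem IsC0Semigroup.continuous_uncurry [CompleteSpace E] {T : ℝ≥0 → E →L[𝕜] E}
    (hT : IsC0Semigroup T) : Continuous fun q : ℝ≥0 × E => T q.1 q.2 := by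
  obtain ⟨M, ω, -, -, hM⟩ := hT.exists_norm_le_exp
  rw [continuous_iff_continuousAt]
  rintro ⟨t₀, x₀⟩
  rw [ContinuousAt, tendsto_iff_norm_sub_tendsto_zero]
  have hg : Continuous fun q : ℝ≥0 × E =>
      M * Real.exp (ω * q.1) * ‖q.2 - x₀‖ + ‖T q.1 x₀ - T t₀ x₀‖ := by
    have := (hT.strong_continuous x₀).comp (continuous_fst (X := ℝ≥0) (Y := E))
    have h2 : Continuous fun q : ℝ≥0 × E => T q.1 x₀ := this
    exact (by fun_prop : Continuous fun q : ℝ≥0 × E => M * Real.exp (ω * q.1) * ‖q.2 - x₀‖).add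
      (h2.sub continuous_const).norm
  refine squeeze_zero (fun _ => norm_nonneg _) (fun q => ?_)
    (by simpa using hg.tendsto (t₀, x₀))
  calc ‖T q.1 q.2 - T t₀ x₀‖ = ‖T q.1 (q.2 - x₀) + (T q.1 x₀ - T t₀ x₀)‖ := by
        rw [map_sub]; congr 1; abel
    _ ≤ ‖T q.1 (q.2 - x₀)‖ + ‖T q.1 x₀ - T t₀ x₀‖ := norm_add_le _ _
    _ ≤ _ := by gcongr; exact (T q.1).le_of_opNorm_le (hM _) _

theorem IsC0Semigroup.map_add_apply {T : ℝ≥0 → E →L[𝕜] E} (hT : IsC0Semigroup T) (s t : ℝ≥0)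
    (x : E) : T (s + t) x = T s (T t x) := by rw [hT.map_add]; rfl

theorem IsC0Semigroup.map_zero_apply {T : ℝ≥0 → E →L[𝕜] E} (hT : IsC0Semigroup T)
    (x : E) : T 0 x = x := by rw [hT.map_zero]; rfl

/-- A semigroup that is strongly continuous at `0` and locally bounded is a `C₀`-semigroup. -/
theorem isC0Semigroup_of_tendsto_zero {T : ℝ≥0 → E →L[𝕜] E}
    (h0 : T 0 = ContinuousLinearMap.id 𝕜 E) (hadd : ∀ s t : ℝ≥0, T (s + t) = (T s).comp (T t))
    (hbdd : ∀ a : ℝ≥0, ∃ C : ℝ, ∀ t ≤ a, ‖T t‖ ≤ C)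
    (hcont : ∀ x, Tendsto (fun h => T h x) (𝓝 0) (𝓝 x)) : IsC0Semigroup T := by
  refine ⟨h0, hadd, fun x => continuous_iff_continuousAt.2 fun t₀ => ?_⟩
  obtain ⟨C, hC⟩ := hbdd (t₀ + 1)
  have hC0 : 0 ≤ C := (norm_nonneg _).trans (hC 0 zero_le)
  -- The increment is $|t-t_0|$: factoring out `T (min t t₀)` treats left and right continuity at
  -- once.
  have hd : Tendsto (fun t : ℝ≥0 => T (max t t₀ - min t t₀) x) (𝓝 t₀) (𝓝 x) := by
    refine (hcont x).comp ?_
    have : Continuous fun t : ℝ≥0 => max t t₀ - min t t₀ := by fun_prop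
    simpa using this.tendsto t₀
  rw [ContinuousAt, tendsto_iff_norm_sub_tendsto_zero]
  rw [tendsto_iff_norm_sub_tendsto_zero] at hd
  refine squeeze_zero' (Eventually.of_forall fun _ => norm_nonneg _) ?_
    (by simpa using hd.const_mul C)
  filter_upwards [Iio_mem_nhds (show t₀ < t₀ + 1 from lt_add_of_pos_right _ one_pos)] with t ht
  have hle : min t t₀ ≤ max t t₀ := min_le_max
  have e : ‖T t x - T t₀ x‖ = ‖T (max t t₀) x - T (min t t₀) x‖ := by
    rcases le_total t t₀ with h | h
    · rw [max_eq_right h, min_eq_left h, norm_sub_rev]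
    · rw [max_eq_left h, min_eq_right h]
  have e2 : T (max t t₀) x = T (min t t₀) (T (max t t₀ - min t t₀) x) := by
    rw [← ContinuousLinearMap.comp_apply, ← hadd, add_tsub_cancel_of_le hle]
  rw [e, e2, ← map_sub]
  exact (T _).le_of_opNorm_le (hC _ ((min_le_left _ _).trans ht.le)) _

/-- Rescaling by `exp (a t)`. -/
def expRescale (a : ℝ) (T : ℝ≥0 → E →L[𝕜] E) (t : ℝ≥0) : E →L[𝕜] E :=
  ((Real.exp (a * t) : ℝ) : 𝕜) • T t

theorem IsC0Semigroup.expRescale {T : ℝ≥0 → E →L[𝕜] E} (hT : IsC0Semigroup T) (a : ℝ) :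
    IsC0Semigroup (expRescale a T) := by
  refine ⟨by simp [_root_.expRescale, hT.map_zero], fun s t => ?_, fun x => ?_⟩
  · ext x
    simp only [_root_.expRescale, hT.map_add_apply, smul_apply,
      ContinuousLinearMap.comp_apply, map_smul, smul_smul, NNReal.coe_add, mul_add, Real.exp_add,
      RCLike.ofReal_mul]
    rw [mul_comm]
  · have := hT.strong_continuous x
    simp only [_root_.expRescale, smul_apply]
    fun_prop

theorem norm_expRescale (T : ℝ≥0 → E →L[𝕜] E) (a : ℝ) (t : ℝ≥0) :
    ‖expRescale a T t‖ = Real.exp (a * t) * ‖T t‖ := by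
  simp [expRescale, norm_smul, abs_of_pos (Real.exp_pos _)]

end C0Semigroup

/-! ### Variation of constants: construction of bounded perturbations. -/

section Duhamel

variable {𝕜 E : Type*} [RCLike 𝕜] [NormedAddCommGroup E] [NormedSpace 𝕜 E]

/-- The convolution integrand `T (t - s) (W (u s))`. -/
def duhamelIntegrand (T : ℝ≥0 → E →L[𝕜] E) (W : E →L[𝕜] E) (u : ℝ≥0 → E) (t s : ℝ) : E :=
  T (t - s).toNNReal (W (u s.toNNReal))

theorem continuous_duhamelIntegrand [CompleteSpace E] {T : ℝ≥0 → E →L[𝕜] E}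
    (hT : IsC0Semigroup T) (W : E →L[𝕜] E) {u : ℝ≥0 → E} (hu : Continuous u) :
    Continuous fun q : ℝ × ℝ => duhamelIntegrand T W u q.1 q.2 := by
  have : Continuous fun q : ℝ × ℝ => ((q.1 - q.2).toNNReal, W (u q.2.toNNReal)) := by fun_prop
  exact hT.continuous_uncurry.comp this

variable [NormedSpace ℝ E]

/-- The variation of constants formula for the perturbation of `T` by `-W`. -/
def IsDuhamelPerturbation (T : ℝ≥0 → E →L[𝕜] E) (W : E →L[𝕜] E) (S : ℝ≥0 → E →L[𝕜] E) : Prop :=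
  ∀ (t : ℝ≥0) (x : E), S t x =
    T t x - ∫ s in (0 : ℝ)..t, duhamelIntegrand T W (fun r => S r x) t s

/-- Since $\int_0^t e^{-l(t-s)}\,ds\le 1/l$ for every $t$, the bound is global in time, and it is a
contraction bound once $M\|W\|<l$. -/
theorem norm_duhamelIntegral_le {T : ℝ≥0 → E →L[𝕜] E}
    (W : E →L[𝕜] E) {M l C : ℝ} (hl : 0 < l) (hM0 : 0 ≤ M)
    (hM : ∀ t, ‖T t‖ ≤ M * Real.exp (-l * t))
    {u : ℝ≥0 → E} (huC : ∀ t, ‖u t‖ ≤ C) (t : ℝ≥0) :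
    ‖∫ s in (0 : ℝ)..t, duhamelIntegrand T W u t s‖ ≤ M * ‖W‖ / l * C := by
  have hC : 0 ≤ C := (norm_nonneg _).trans (huC 0)
  have hint : ∫ s in (0 : ℝ)..t, M * ‖W‖ * C * Real.exp (-l * (t - s)) ≤ M * ‖W‖ / l * C := by
    have : ∀ s ∈ Set.uIcc (0 : ℝ) t, HasDerivAt
        (fun s : ℝ => M * ‖W‖ * C * (Real.exp (-l * (t - s)) / l))
        (M * ‖W‖ * C * Real.exp (-l * (t - s))) s := by
      intro s _
      have h1 : HasDerivAt (fun s : ℝ => -l * (t - s)) l s := by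
        simpa using ((hasDerivAt_id s).const_sub (t : ℝ)).const_mul (-l)
      have h2 := (h1.exp.div_const l).const_mul (M * ‖W‖ * C)
      rwa [mul_div_assoc, div_self hl.ne', mul_one] at h2
    rw [intervalIntegral.integral_eq_sub_of_hasDerivAt this (by
      apply Continuous.intervalIntegrable; fun_prop)]
    have hW := norm_nonneg W
    have h3 : 0 ≤ M * ‖W‖ * C * (Real.exp (-l * (t - 0)) / l) := by positivity
    have h4 : M * ‖W‖ * C * (Real.exp (-l * (t - t)) / l) = M * ‖W‖ / l * C := by
      simp; ring
    linarith
  refine le_trans ?_ hint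
  refine intervalIntegral.norm_integral_le_of_norm_le t.2 ?_
    (by apply Continuous.intervalIntegrable; fun_prop)
  refine Eventually.of_forall fun s hs => ?_
  rw [duhamelIntegrand]
  refine ((T _).le_opNorm _).trans ?_
  have h1 := hM ((t : ℝ) - s).toNNReal
  rw [Real.coe_toNNReal _ (by linarith [hs.2])] at h1
  have h2 : ‖W (u s.toNNReal)‖ ≤ ‖W‖ * C := W.le_opNorm_of_le (huC _)
  calc _ ≤ (M * Real.exp (-l * (t - s))) * (‖W‖ * C) := by gcongr
    _ = _ := by ring

open BoundedContinuousFunction in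
/-- The Volterra operator `u ↦ ∫₀ᵗ T (t - s) W u(s) ds` on bounded continuous functions, for an
exponentially stable semigroup. -/
theorem exists_volterra [CompleteSpace E] [IsScalarTower ℝ 𝕜 E] {T : ℝ≥0 → E →L[𝕜] E}
    (hT : IsC0Semigroup T) (W : E →L[𝕜] E) {M l : ℝ} (hl : 0 < l) (hM0 : 0 ≤ M)
    (hM : ∀ t, ‖T t‖ ≤ M * Real.exp (-l * t)) :
    ∃ K : (ℝ≥0 →ᵇ E) →L[𝕜] (ℝ≥0 →ᵇ E), ‖K‖ ≤ M * ‖W‖ / l ∧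
      ∀ u t, K u t = ∫ s in (0 : ℝ)..t, duhamelIntegrand T W u t s := by
  have hcont : ∀ u : ℝ≥0 →ᵇ E, Continuous fun t : ℝ≥0 =>
      ∫ s in (0 : ℝ)..t, duhamelIntegrand T W u t s := fun u =>
    intervalIntegral.continuous_parametric_intervalIntegral_of_continuous
      (f := fun (t : ℝ≥0) s => duhamelIntegrand T W u t s)
      ((continuous_duhamelIntegrand hT W u.continuous).comp
        (f := fun q : ℝ≥0 × ℝ => ((q.1 : ℝ), q.2)) (by fun_prop)) (by fun_prop)
  have hbd : ∀ (u : ℝ≥0 →ᵇ E) (t : ℝ≥0),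
      ‖∫ s in (0 : ℝ)..t, duhamelIntegrand T W u t s‖ ≤ M * ‖W‖ / l * ‖u‖ := fun u t =>
    norm_duhamelIntegral_le W hl hM0 hM u.norm_coe_le_norm t
  have hii : ∀ (u : ℝ≥0 →ᵇ E) (t : ℝ≥0),
      IntervalIntegrable (duhamelIntegrand T W u t) volume 0 t := fun u t =>
    ((continuous_duhamelIntegrand hT W u.continuous).comp
      (f := fun s : ℝ => ((t : ℝ), s)) (by fun_prop)).intervalIntegrable _ _
  let K₀ : (ℝ≥0 →ᵇ E) →ₗ[𝕜] (ℝ≥0 →ᵇ E) :=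
    { toFun := fun u => BoundedContinuousFunction.ofNormedAddCommGroup _ (hcont u) _ (hbd u)
      map_add' := fun u v => by
        ext t
        simp only [coe_ofNormedAddCommGroup, coe_add, Pi.add_apply]
        rw [← intervalIntegral.integral_add (hii u t) (hii v t)]
        simp [duhamelIntegrand]
      map_smul' := fun c u => by
        ext t
        simp only [coe_ofNormedAddCommGroup, coe_smul, RingHom.id_apply]
        rw [← intervalIntegral.integral_smul]
        simp [duhamelIntegrand] }
  have hK : ∀ u, ‖K₀ u‖ ≤ M * ‖W‖ / l * ‖u‖ := fun u =>
    (BoundedContinuousFunction.norm_le (by positivity)).2 fun t => hbd u t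
  exact ⟨K₀.mkContinuous _ hK, K₀.mkContinuous_norm_le (by positivity) hK, fun u t => rfl⟩

open BoundedContinuousFunction in
-- The orbits solve $(1+K)u=T(\cdot)x$, which a Neumann series inverts on bounded continuous
-- functions. The semigroup law is uniqueness: the orbit shifted by $s$ solves the same equation
-- with initial value $S(s)x$.
theorem exists_duhamel_of_stable [CompleteSpace E] [IsScalarTower ℝ 𝕜 E] {T : ℝ≥0 → E →L[𝕜] E}
    (hT : IsC0Semigroup T) (W : E →L[𝕜] E) {M l : ℝ} (hl : 0 < l) (hM0 : 0 ≤ M)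
    (hM : ∀ t, ‖T t‖ ≤ M * Real.exp (-l * t)) (hsmall : M * ‖W‖ / l < 1) :
    ∃ S : ℝ≥0 → E →L[𝕜] E, IsC0Semigroup S ∧ IsDuhamelPerturbation T W S := by
  obtain ⟨K, hKn, hK⟩ := exists_volterra hT W hl hM0 hM
  have hK1 : ‖-K‖ < 1 := by rw [norm_neg]; exact hKn.trans_lt hsmall
  set U := Units.oneSub (-K) hK1
  set R : (ℝ≥0 →ᵇ E) →L[𝕜] (ℝ≥0 →ᵇ E) := ((U⁻¹ : ((ℝ≥0 →ᵇ E) →L[𝕜] (ℝ≥0 →ᵇ E))ˣ) : (ℝ≥0 →ᵇ E) →L[𝕜] (ℝ≥0 →ᵇ E)) with hR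
  have hUv : ∀ v, (U : (ℝ≥0 →ᵇ E) →L[𝕜] (ℝ≥0 →ᵇ E)) v = v + K v := fun v => by
    simp [U, Units.val_oneSub]
  have hUR : ∀ v, R v + K (R v) = v := fun v => by
    rw [← hUv, ← mul_apply_eq_comp, hR, Units.mul_inv]; rfl
  have hRU : ∀ v, R (v + K v) = v := fun v => by
    rw [← hUv, ← mul_apply_eq_comp, hR, Units.inv_mul]; rfl
  have hTb : ∀ (x : E) (t : ℝ≥0), ‖T t x‖ ≤ M * ‖x‖ := fun x t =>
    (T t).le_of_opNorm_le ((hM t).trans (mul_le_of_le_one_right hM0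
      (Real.exp_le_one_iff.2 (by nlinarith [t.2])))) x
  let ι₀ : E →ₗ[𝕜] (ℝ≥0 →ᵇ E) :=
    { toFun := fun x => ofNormedAddCommGroup (fun t => T t x) (hT.strong_continuous x) _ (hTb x)
      map_add' := fun x y => by ext t; simp
      map_smul' := fun c x => by ext t; simp }
  let ι : E →L[𝕜] (ℝ≥0 →ᵇ E) := ι₀.mkContinuous M fun x =>
    (BoundedContinuousFunction.norm_le (by positivity)).2 fun t => hTb x t
  have hι : ∀ x t, ι x t = T t x := fun x t => rfl
  let S : ℝ≥0 → E →L[𝕜] E := fun t => (evalCLM 𝕜 t).comp (R.comp ι)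
  have hS : ∀ t x, S t x = R (ι x) t := fun t x => rfl
  have hSd : IsDuhamelPerturbation T W S := fun t x => by
    have h := DFunLike.congr_fun (hUR (ι x)) t
    rw [BoundedContinuousFunction.add_apply, hK, hι] at h
    rw [← h, hS]
    simp only [hS, add_sub_cancel_right]
  refine ⟨S, ⟨?_, ?_, fun x => (R (ι x)).continuous⟩, hSd⟩
  · ext x
    rw [hSd, hT.map_zero]
    simp
  · intro t s
    ext x
    set y := S s x
    let v : ℝ≥0 →ᵇ E := (R (ι x)).compContinuous ⟨fun r => r + s, by fun_prop⟩
    have hv : ∀ r, v r = S (r + s) x := fun r => rfl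
    -- Splitting the integral over $[0,r+s]$ at $s$ gives $T(r)$ of the integral defining $S(s)x$,
    -- plus the Volterra term of the shifted orbit.
    have hvK : v + K v = ι y := by
      ext r
      rw [BoundedContinuousFunction.add_apply, hK, hι, hv, hSd (r + s) x]
      have hc : Continuous fun q : ℝ × ℝ => duhamelIntegrand T W (fun r => S r x) q.1 q.2 :=
        continuous_duhamelIntegrand hT W (R (ι x)).continuous
      have hi : ∀ a b : ℝ, IntervalIntegrable
          (duhamelIntegrand T W (fun r => S r x) ((r + s : ℝ≥0) : ℝ)) volume a b := fun a b =>
        (hc.comp (f := fun z : ℝ => (((r + s : ℝ≥0) : ℝ), z)) (by fun_prop)).intervalIntegrable _ _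
      have hi' : IntervalIntegrable (duhamelIntegrand T W (fun r => S r x) (s : ℝ)) volume 0 s :=
        (hc.comp (f := fun z : ℝ => ((s : ℝ), z)) (by fun_prop)).intervalIntegrable _ _
      rw [← intervalIntegral.integral_add_adjacent_intervals (hi 0 s) (hi s _)]
      have e1 : ∫ z in (0 : ℝ)..s, duhamelIntegrand T W (fun r => S r x) ((r + s : ℝ≥0) : ℝ) z
          = T r (∫ z in (0 : ℝ)..s, duhamelIntegrand T W (fun r => S r x) s z) := by
        rw [← ContinuousLinearMap.intervalIntegral_comp_comm _ hi']
        refine intervalIntegral.integral_congr fun z hz => ?_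
        rw [Set.uIcc_of_le s.coe_nonneg] at hz
        simp only [duhamelIntegrand]
        rw [← hT.map_add_apply]
        congr 2
        rw [NNReal.coe_add, add_sub_assoc, Real.toNNReal_add r.coe_nonneg (sub_nonneg.2 hz.2),
          Real.toNNReal_coe]
      have e2 : ∫ z in (s : ℝ)..((r + s : ℝ≥0) : ℝ),
            duhamelIntegrand T W (fun r => S r x) ((r + s : ℝ≥0) : ℝ) z
          = ∫ z in (0 : ℝ)..r, duhamelIntegrand T W v r z := by
        have := intervalIntegral.integral_comp_add_right (a := 0) (b := (r : ℝ))
          (duhamelIntegrand T W (fun r => S r x) ((r + s : ℝ≥0) : ℝ)) (s : ℝ)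
        rw [zero_add, ← NNReal.coe_add] at this
        rw [← this]
        refine intervalIntegral.integral_congr fun z hz => ?_
        rw [Set.uIcc_of_le r.coe_nonneg] at hz
        simp only [duhamelIntegrand, hv]
        rw [NNReal.coe_add, add_sub_add_right_eq_sub, Real.toNNReal_add hz.1 s.coe_nonneg,
          Real.toNNReal_coe]
      rw [e1, e2, hT.map_add_apply]
      have e3 : T r y = T r (T s x)
          - T r (∫ z in (0 : ℝ)..s, duhamelIntegrand T W (fun r => S r x) s z) := by
        rw [← map_sub, ← hSd]
      rw [e3]; abel
    have : v = R (ι y) := by rw [← hvK, hRU]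
    exact DFunLike.congr_fun this t

theorem exists_duhamel [CompleteSpace E] [IsScalarTower ℝ 𝕜 E] {T : ℝ≥0 → E →L[𝕜] E}
    (hT : IsC0Semigroup T) (W : E →L[𝕜] E) :
    ∃ S : ℝ≥0 → E →L[𝕜] E, IsC0Semigroup S ∧ IsDuhamelPerturbation T W S := by
  obtain ⟨M, ω, hM1, hω, hM⟩ := hT.exists_norm_le_exp
  have hM0 : 0 ≤ M := zero_le_one.trans hM1
  -- Rescaling by $e^{-(\omega+l)t}$ leaves decay rate `l`, and this `l` gives $M\|W\|/l<1$.
  -- Rescaling back restores the equation because the exponentials at $t-s$ and $s$ multiply to the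
  -- one at $t$.
  set l : ℝ := M * ‖W‖ + 1
  have hl : 0 < l := by positivity
  obtain ⟨S, hS, hSd⟩ := exists_duhamel_of_stable (hT.expRescale (-(ω + l))) W hl hM0 (fun t => by
    rw [norm_expRescale]
    calc _ ≤ Real.exp (-(ω + l) * t) * (M * Real.exp (ω * t)) := by gcongr; exact hM t
      _ = M * (Real.exp (-(ω + l) * t) * Real.exp (ω * t)) := by ring
      _ = _ := by rw [← Real.exp_add]; ring_nf
      _ ≤ _ := le_rfl) ((div_lt_one hl).2 (lt_add_one _))
  refine ⟨expRescale (ω + l) S, hS.expRescale _, fun t x => ?_⟩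
  have e : ∀ t : ℝ≥0, ((Real.exp ((ω + l) * t) : ℝ) : 𝕜) • expRescale (-(ω + l)) T t x = T t x := by
    intro t
    rw [expRescale, smul_apply, smul_smul, ← RCLike.ofReal_mul, ← Real.exp_add,
      ← add_mul, add_neg_cancel, zero_mul, Real.exp_zero, RCLike.ofReal_one, one_smul]
  rw [expRescale, smul_apply, hSd, smul_sub, e, ← intervalIntegral.integral_smul]
  congr 1
  refine intervalIntegral.integral_congr fun s hs => ?_
  rw [Set.uIcc_of_le t.coe_nonneg] at hs
  simp only [duhamelIntegrand, expRescale, smul_apply, map_smul, smul_smul]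
  congr 1
  rw [← RCLike.ofReal_mul, ← Real.exp_add, Real.coe_toNNReal _ (sub_nonneg.2 hs.2),
    Real.coe_toNNReal _ hs.1]
  congr 2; ring

end Duhamel

/-! ### Generators: dense domain, uniqueness, and the effect of a bounded perturbation. -/

section Generator

variable {𝕜 E : Type*} [RCLike 𝕜] [NormedAddCommGroup E] [NormedSpace 𝕜 E] [CompleteSpace E]

theorem InGenerator.apply_semigroup {T : ℝ≥0 → E →L[𝕜] E} (hT : IsC0Semigroup T) {x y : E}
    (h : InGenerator T x y) (s : ℝ≥0) : InGenerator T (T s x) (T s y) := by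
  have := ((T s).continuous.tendsto y).comp h
  refine this.congr fun r => ?_
  simp only [Function.comp, map_smul, map_sub, ← hT.map_add_apply, add_comm]

variable [NormedSpace ℝ E]

/-- The average of the orbit of `x` over `[a, a + h]`. -/
def orbitAverage (T : ℝ≥0 → E →L[𝕜] E) (a h : ℝ≥0) (x : E) : E :=
  ∫ r in (0 : ℝ)..1, T (a + h * r.toNNReal) x

theorem continuous_orbitAverage {T : ℝ≥0 → E →L[𝕜] E} (hT : IsC0Semigroup T) (a : ℝ≥0) (x : E) :
    Continuous fun h => orbitAverage T a h x := by
  refine intervalIntegral.continuous_parametric_intervalIntegral_of_continuous'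
    (f := fun (h : ℝ≥0) (r : ℝ) => T (a + h * r.toNNReal) x) ?_ _ _
  exact (hT.strong_continuous x).comp
    (f := fun q : ℝ≥0 × ℝ => a + q.1 * q.2.toNNReal) (by fun_prop)

theorem orbitAverage_zero (T : ℝ≥0 → E →L[𝕜] E) (a : ℝ≥0) (x : E) :
    orbitAverage T a 0 x = T a x := by simp [orbitAverage]

theorem smul_orbitAverage (T : ℝ≥0 → E →L[𝕜] E) (a h : ℝ≥0) (x : E) :
    (h : ℝ) • orbitAverage T a h x = ∫ s in (a : ℝ)..a + h, T s.toNNReal x := by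
  rw [orbitAverage]
  have := intervalIntegral.smul_integral_comp_add_mul (a := 0) (b := 1)
    (fun s : ℝ => T s.toNNReal x) (h : ℝ) (a : ℝ)
  rw [mul_zero, add_zero, mul_one] at this
  rw [← this]
  congr 1
  refine intervalIntegral.integral_congr fun r hr => ?_
  rw [Set.uIcc_of_le zero_le_one] at hr
  rw [Real.toNNReal_add a.coe_nonneg (mul_nonneg h.coe_nonneg hr.1), Real.toNNReal_coe,
    Real.toNNReal_mul h.coe_nonneg, Real.toNNReal_coe]

variable [IsScalarTower ℝ 𝕜 E]

/-- Applying $T(k)-1$ to $\int_0^h T(s)x\,ds$ leaves only the end pieces $\int_h^{h+k}-\int_0^k$,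
and their averages converge to $T(h)x$ and $x$ as $k\to0$. -/
theorem inGenerator_orbitAverage {T : ℝ≥0 → E →L[𝕜] E} (hT : IsC0Semigroup T) {h : ℝ≥0}
    (hh : h ≠ 0) (x : E) :
    InGenerator T (orbitAverage T 0 h x) ((h : ℝ)⁻¹ • (T h x - x)) := by
  have hlim : Tendsto (fun k => (h : ℝ)⁻¹ • (orbitAverage T h k x - orbitAverage T 0 k x))
      (𝓝[>] 0) (𝓝 ((h : ℝ)⁻¹ • (T h x - x))) := by
    have hc : Continuous fun k => (h : ℝ)⁻¹ • (orbitAverage T h k x - orbitAverage T 0 k x) :=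
      ((continuous_orbitAverage hT h x).sub (continuous_orbitAverage hT 0 x)).const_smul _
    have := hc.tendsto 0
    rw [orbitAverage_zero, orbitAverage_zero, hT.map_zero_apply] at this
    exact this.mono_left nhdsWithin_le_nhds
  refine hlim.congr' ?_
  filter_upwards [self_mem_nhdsWithin] with k hk
  have hk0 : (k : ℝ) ≠ 0 := by exact_mod_cast (ne_of_gt hk)
  have hh0 : (h : ℝ) ≠ 0 := by exact_mod_cast hh
  have hi : ∀ a b : ℝ, IntervalIntegrable (fun s : ℝ => T s.toNNReal x) volume a b := fun a b =>
    ((hT.strong_continuous x).comp continuous_real_toNNReal).intervalIntegrable _ _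
  rw [← RCLike.ofReal_inv, RCLike.real_smul_eq_coe_smul (K := 𝕜) (h : ℝ)⁻¹,
    ← RCLike.real_smul_eq_coe_smul, ← RCLike.real_smul_eq_coe_smul]
  have e1 : T k (orbitAverage T 0 h x) = orbitAverage T k h x := by
    rw [orbitAverage, orbitAverage, ← ContinuousLinearMap.intervalIntegral_comp_comm]
    · simp only [← hT.map_add_apply, zero_add]
    · exact ((hT.strong_continuous x).comp
        (f := fun r : ℝ => 0 + h * r.toNNReal) (by fun_prop)).intervalIntegrable _ _
  have e2 : (h : ℝ) • (orbitAverage T k h x - orbitAverage T 0 h x) =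
      (k : ℝ) • (orbitAverage T h k x - orbitAverage T 0 k x) := by
    simp only [smul_sub, smul_orbitAverage, NNReal.coe_zero, zero_add]
    have a1 := intervalIntegral.integral_add_adjacent_intervals (hi 0 k) (hi k (k + h))
    have a2 := intervalIntegral.integral_add_adjacent_intervals (hi 0 h) (hi h (h + k))
    rw [add_comm (h : ℝ) k] at a2 ⊢
    rw [← eq_sub_iff_add_eq'] at a1 a2
    rw [a1, a2]; abel
  rw [e1, ← smul_right_injective _ hh0 |>.eq_iff, ← smul_right_injective _ hk0 |>.eq_iff]
  rw [smul_smul (h : ℝ), mul_inv_cancel₀ hh0, one_smul, ← e2, smul_comm (h : ℝ) (k : ℝ)⁻¹,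
    smul_smul (k : ℝ), mul_inv_cancel₀ hk0, one_smul]

theorem dense_generator_domain {T : ℝ≥0 → E →L[𝕜] E} (hT : IsC0Semigroup T) :
    Dense {x | ∃ y, InGenerator T x y} := by
  intro x
  have h : Tendsto (fun h => orbitAverage T 0 h x) (𝓝[>] 0) (𝓝 x) := by
    have := (continuous_orbitAverage hT 0 x).tendsto 0
    rw [orbitAverage_zero, hT.map_zero_apply] at this
    exact this.mono_left nhdsWithin_le_nhds
  refine mem_closure_of_tendsto h ?_
  filter_upwards [self_mem_nhdsWithin] with k hk
  exact ⟨_, inGenerator_orbitAverage hT (ne_of_gt hk) x⟩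

/-- For $x$ in the domain of the generator of $S$, the curve $s\mapsto T(t-s)S(s)x$ has right
derivative zero, so its endpoint values $T(t)x$ and $S(t)x$ agree; such $x$ are dense. -/
theorem IsC0Semigroup.eq_of_inGenerator_le {S T : ℝ≥0 → E →L[𝕜] E} (hS : IsC0Semigroup S)
    (hT : IsC0Semigroup T) (h : ∀ x y, InGenerator S x y → InGenerator T x y) : S = T := by
  funext t
  refine ContinuousLinearMap.coeFn_injective <| (S t).continuous.ext_on
    (dense_generator_domain hS) (T t).continuous ?_
  rintro x ⟨y, hxy⟩
  set φ : ℝ → E := fun s => T (t - s).toNNReal (S s.toNNReal x) with hφ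
  have hφc : Continuous φ := by
    have : Continuous fun s : ℝ => ((t - s).toNNReal, S s.toNNReal x) := by
      have := (hS.strong_continuous x).comp continuous_real_toNNReal
      exact Continuous.prodMk (by fun_prop) this
    exact hT.continuous_uncurry.comp this
  have hder : ∀ s ∈ Set.Ico (0 : ℝ) t, HasDerivWithinAt φ 0 (Set.Ici s) s := by
    intro s hs
    lift s to ℝ≥0 using hs.1
    have hst : s < t := by exact_mod_cast hs.2
    rw [← hasDerivWithinAt_Ioi_iff_Ici, hasDerivWithinAt_iff_tendsto_slope' (by simp)]
    have hz := hxy.apply_semigroup hS s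
    set z := S s x
    -- The slope of `φ` between `s` and `r` is `T (t - r)` applied to this quotient at `h = r - s`;
    -- joint continuity then gives the limit.
    have hd : Tendsto (fun h : ℝ≥0 => (((h : ℝ) : 𝕜))⁻¹ • (S h z - T h z)) (𝓝[>] 0) (𝓝 0) := by
      have := Tendsto.sub hz (h _ _ hz)
      rw [sub_self] at this
      refine this.congr fun r => ?_
      rw [← smul_sub]; congr 1; abel
    have hsub : Tendsto (fun r : ℝ => r.toNNReal - s) (𝓝[>] (s : ℝ)) (𝓝[>] 0) := by
      refine tendsto_nhdsWithin_iff.2 ⟨?_, ?_⟩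
      · have : Continuous fun r : ℝ => r.toNNReal - s := by fun_prop
        simpa using (this.tendsto (s : ℝ)).mono_left nhdsWithin_le_nhds
      · filter_upwards [self_mem_nhdsWithin] with r hr
        exact tsub_pos_of_lt (Real.lt_toNNReal_iff_coe_lt.2 hr)
    have h3 : Tendsto (fun r : ℝ => ((t - r).toNNReal, ((((r.toNNReal - s : ℝ≥0) : ℝ) : 𝕜))⁻¹ •
        (S (r.toNNReal - s) z - T (r.toNNReal - s) z))) (𝓝[>] (s : ℝ))
        (𝓝 (((t : ℝ) - s).toNNReal, (0 : E))) := by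
      refine Tendsto.prodMk_nhds ?_ (hd.comp hsub)
      have : Continuous fun r : ℝ => ((t : ℝ) - r).toNNReal := by fun_prop
      exact (this.tendsto _).mono_left nhdsWithin_le_nhds
    have h4 := (hT.continuous_uncurry.tendsto _).comp h3
    have hz0 : (T ((t : ℝ) - s).toNNReal) (0 : E) = 0 := _root_.map_zero _
    rw [hz0] at h4
    refine h4.congr' ?_
    filter_upwards [self_mem_nhdsWithin, mem_nhdsWithin_of_mem_nhds (Iio_mem_nhds hs.2)]
      with r hr hrt
    have hr' : (s : ℝ) < r := hr
    have hrt' : r < t := hrt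
    lift r to ℝ≥0 using s.coe_nonneg.trans hr'.le
    have hsr : s < r := by exact_mod_cast hr'
    have hrt2 : r < t := by exact_mod_cast hrt'
    have e0 : ((t : ℝ) - r).toNNReal = t - r := by
      rw [← NNReal.coe_sub hrt2.le, Real.toNNReal_coe]
    have e0' : ((t : ℝ) - s).toNNReal = t - s := by
      rw [← NNReal.coe_sub hst.le, Real.toNNReal_coe]
    have e1 : S r x = S (r - s) z := by
      rw [← hS.map_add_apply, tsub_add_cancel_of_le hsr.le]
    have e2 : T (t - s) z = T (t - r) (T (r - s) z) := by
      rw [← hT.map_add_apply, tsub_add_tsub_cancel hrt2.le hsr.le]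
    simp only [Function.comp, slope, vsub_eq_sub, hφ, Real.toNNReal_coe, e0, e0', map_smul]
    rw [e1, e2, map_sub, ← RCLike.ofReal_inv, ← RCLike.real_smul_eq_coe_smul,
      NNReal.coe_sub hsr.le]
  have := constant_of_has_deriv_right_zero hφc.continuousOn hder t ⟨t.coe_nonneg, le_rfl⟩
  simpa [hφ, hT.map_zero_apply, hS.map_zero_apply] using this

/-- The scaled convolution term in the variation of constants formula. -/
def duhamelAverage (T : ℝ≥0 → E →L[𝕜] E) (W : E →L[𝕜] E) (S : ℝ≥0 → E →L[𝕜] E) (h : ℝ≥0)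
    (x : E) : E :=
  ∫ r in (0 : ℝ)..1, duhamelIntegrand T W (fun t => S t x) h (h * r)

theorem continuous_duhamelAverage {T S : ℝ≥0 → E →L[𝕜] E} (hT : IsC0Semigroup T)
    (hS : IsC0Semigroup S) (W : E →L[𝕜] E) :
    Continuous fun q : ℝ≥0 × E => duhamelAverage T W S q.1 q.2 := by
  refine intervalIntegral.continuous_parametric_intervalIntegral_of_continuous'
    (f := fun (q : ℝ≥0 × E) (r : ℝ) => duhamelIntegrand T W (fun t => S t q.2) q.1 (q.1 * r))
    ?_ _ _
  have h1 : Continuous fun q : (ℝ≥0 × E) × ℝ => S ((q.1.1 : ℝ) * q.2).toNNReal q.1.2 :=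
    hS.continuous_uncurry.comp (f := fun q : (ℝ≥0 × E) × ℝ => (((q.1.1 : ℝ) * q.2).toNNReal, q.1.2))
      (by fun_prop)
  exact hT.continuous_uncurry.comp
    (f := fun q : (ℝ≥0 × E) × ℝ => (((q.1.1 : ℝ) - q.1.1 * q.2).toNNReal,
      W (S ((q.1.1 : ℝ) * q.2).toNNReal q.1.2)))
      (Continuous.prodMk (by fun_prop) (W.continuous.comp h1))

theorem duhamelAverage_zero {T S : ℝ≥0 → E →L[𝕜] E} (hT : IsC0Semigroup T)
    (hS : IsC0Semigroup S) (W : E →L[𝕜] E) (x : E) : duhamelAverage T W S 0 x = W x := by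
  simp [duhamelAverage, duhamelIntegrand, hT.map_zero_apply, hS.map_zero_apply]

theorem IsDuhamelPerturbation.apply_eq {T S : ℝ≥0 → E →L[𝕜] E} {W : E →L[𝕜] E}
    (h : IsDuhamelPerturbation T W S) (t : ℝ≥0) (x : E) :
    S t x = T t x - ((t : ℝ) : 𝕜) • duhamelAverage T W S t x := by
  rw [h t x, duhamelAverage, ← RCLike.real_smul_eq_coe_smul,
    intervalIntegral.smul_integral_comp_mul_left]
  simp

/-- The difference quotients of `S` and `T` at $x$ differ by `duhamelAverage`, which tends to $Wx$.
-/
theorem IsDuhamelPerturbation.inGenerator_iff {T S : ℝ≥0 → E →L[𝕜] E} {W : E →L[𝕜] E}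
    (hT : IsC0Semigroup T) (hS : IsC0Semigroup S) (h : IsDuhamelPerturbation T W S) (x y : E) :
    InGenerator S x y ↔ InGenerator T x (y + W x) := by
  have hJ : Tendsto (fun k : ℝ≥0 => duhamelAverage T W S k x) (𝓝[>] 0) (𝓝 (W x)) := by
    have hc : Continuous fun k : ℝ≥0 => duhamelAverage T W S k x :=
      (continuous_duhamelAverage hT hS W).comp (f := fun k : ℝ≥0 => (k, x)) (by fun_prop)
    have := hc.tendsto 0
    rw [duhamelAverage_zero hT hS] at this
    exact this.mono_left nhdsWithin_le_nhds
  have e : ∀ᶠ k : ℝ≥0 in 𝓝[>] 0, (((k : ℝ) : 𝕜))⁻¹ • (S k x - x) =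
      (((k : ℝ) : 𝕜))⁻¹ • (T k x - x) - duhamelAverage T W S k x := by
    filter_upwards [self_mem_nhdsWithin] with k hk
    have hk0 : ((k : ℝ) : 𝕜) ≠ 0 := by
      rw [RCLike.ofReal_ne_zero]; exact_mod_cast (ne_of_gt hk)
    rw [h.apply_eq k x, sub_right_comm, smul_sub, smul_smul, inv_mul_cancel₀ hk0, one_smul]
  constructor
  · intro hx
    refine (Tendsto.add hx hJ).congr' ?_
    filter_upwards [e] with k hk
    rw [hk, sub_add_cancel]
  · intro hx
    have := Tendsto.sub hx hJ
    rw [add_sub_cancel_right] at this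
    refine this.congr' ?_
    filter_upwards [e] with k hk
    rw [hk]

end Generator

/-! ### The Trotter product formula: stability, consistency, convergence. -/

section Trotter

variable {𝕜 E : Type*} [RCLike 𝕜] [NormedAddCommGroup E] [NormedSpace 𝕜 E] [CompleteSpace E]

/-- Bounding each factor separately would give $M^j$. Carrying a free `T r` through the induction
merges it with the next `T h`, so `M` appears once in front; the remainder `B - 1` costs a factor
$1+Mch\le e^{Mch}$ per step. -/
theorem norm_comp_pow_le {T : ℝ≥0 → E →L[𝕜] E} (hT : IsC0Semigroup T) {M ω c : ℝ} (hM0 : 0 ≤ M)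
    (hM : ∀ t : ℝ≥0, ‖T t‖ ≤ M * Real.exp (ω * t)) {h : ℝ≥0} {B : E →L[𝕜] E}
    (hB : ‖B - 1‖ ≤ c * h) (j : ℕ) (r : ℝ≥0) :
    ‖T r * (T h * B) ^ j‖ ≤ M * Real.exp (ω * r) * Real.exp (j * h * (ω + M * c)) := by
  induction j generalizing r with
  | zero => simpa using hM r
  | succ j ih =>
    have hch : 0 ≤ c * h := (norm_nonneg _).trans hB
    have h0 : ‖(T h * B) ^ j‖ ≤ M * Real.exp (j * h * (ω + M * c)) := by
      simpa [hT.map_zero, ← ContinuousLinearMap.one_def] using ih 0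
    have e : T r * (T h * B) ^ (j + 1) =
        T (r + h) * (T h * B) ^ j + T (r + h) * ((B - 1) * (T h * B) ^ j) := by
      have : T (r + h) = T r * T h := hT.map_add r h
      rw [this, pow_succ']
      noncomm_ring
    rw [e]
    calc _ ≤ ‖T (r + h) * (T h * B) ^ j‖ + ‖T (r + h) * ((B - 1) * (T h * B) ^ j)‖ :=
          norm_add_le _ _
      _ ≤ M * Real.exp (ω * ↑(r + h)) * Real.exp (j * h * (ω + M * c)) +
          (M * Real.exp (ω * ↑(r + h))) * ((c * h) * (M * Real.exp (j * h * (ω + M * c)))) := by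
          refine add_le_add (ih _) ((norm_mul_le _ _).trans ?_)
          refine mul_le_mul (hM _) ((norm_mul_le _ _).trans ?_) (norm_nonneg _) (by positivity)
          exact mul_le_mul hB h0 (norm_nonneg _) hch
      _ = M * Real.exp (ω * ↑(r + h)) * Real.exp (j * h * (ω + M * c)) * (M * c * h + 1) := by ring
      _ ≤ M * Real.exp (ω * ↑(r + h)) * Real.exp (j * h * (ω + M * c)) *
          Real.exp (M * c * h) := by
          gcongr
          exact Real.add_one_le_exp _
      _ = _ := by
          simp only [mul_assoc M, ← Real.exp_add]
          push_cast
          ring_nf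

/-- Telescoping: $S(h)^N-F^N=\sum F^{m}(S(h)-F)S(h)^{k}$ over $m+k=N-1$. The local errors are needed
only along the orbit of $x$. -/
theorem norm_semigroup_sub_pow_le {S : ℝ≥0 → E →L[𝕜] E} (hS : IsC0Semigroup S) {F : E →L[𝕜] E}
    {h : ℝ≥0} {x : E} {N : ℕ} {B ε : ℝ} (hB : ∀ j ≤ N, ‖F ^ j‖ ≤ B)
    (hε : ∀ j < N, ‖S h (S (j * h) x) - F (S (j * h) x)‖ ≤ ε) :
    ‖S (N * h) x - (F ^ N) x‖ ≤ N * (B * ε) := by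
  have hB0 : 0 ≤ B := (norm_nonneg _).trans (hB 0 (Nat.zero_le _))
  have key : ∀ k m : ℕ, m + k ≤ N →
      ‖(F ^ m) (S (k * h) x - (F ^ k) x)‖ ≤ k * (B * ε) := by
    intro k
    induction k with
    | zero => intro m _; simp [hS.map_zero_apply]
    | succ k ih =>
      intro m hm
      have e : (F ^ m) (S (((k + 1 : ℕ) : ℝ≥0) * h) x - (F ^ (k + 1)) x) =
          (F ^ m) (S h (S (k * h) x) - F (S (k * h) x)) +
            (F ^ (m + 1)) (S (k * h) x - (F ^ k) x) := by
        have e1 : (((k + 1 : ℕ) : ℝ≥0) * h) = h + k * h := by push_cast; ring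
        rw [e1, hS.map_add_apply, pow_succ' F k, pow_succ F m, mul_apply_eq_comp,
          mul_apply_eq_comp, ← map_add, map_sub F]
        congr 1; abel
      rw [e]
      calc _ ≤ _ := norm_add_le _ _
        _ ≤ B * ε + k * (B * ε) := by
          refine add_le_add (((F ^ m).le_opNorm _).trans ?_) (ih (m + 1) (by omega))
          exact mul_le_mul (hB m (by omega)) (hε k (by omega)) (norm_nonneg _) hB0
        _ = _ := by push_cast; ring
  simpa using key N 0 (by omega)

variable [NormedSpace ℝ E] [IsScalarTower ℝ 𝕜 E]

/-- The Trotter product formula for a bounded perturbation. -/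
theorem IsDuhamelPerturbation.tendsto_pow {T S : ℝ≥0 → E →L[𝕜] E} {W : E →L[𝕜] E}
    (hT : IsC0Semigroup T) (hS : IsC0Semigroup S) (hd : IsDuhamelPerturbation T W S)
    {G : ℝ≥0 → E →L[𝕜] E} {C : ℝ}
    (hG : ∀ᶠ h : ℝ≥0 in 𝓝 0, ‖G h - 1 + ((h : ℝ) : 𝕜) • W‖ ≤ C * (h : ℝ) ^ 2)
    (t : ℝ≥0) (x : E) :
    Tendsto (fun k : ℕ => ((T (t / (k + 1)) * G (t / (k + 1))) ^ (k + 1)) x) atTop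
      (𝓝 (S t x)) := by
  obtain ⟨M, ω, hM1, hω, hM⟩ := hT.exists_norm_le_exp
  have hM0 : 0 ≤ M := zero_le_one.trans hM1
  set c : ℝ := ‖W‖ + |C|
  have hc0 : 0 ≤ c := by positivity
  have hG1 : ∀ᶠ h : ℝ≥0 in 𝓝 0, ‖G h - 1‖ ≤ c * h := by
    filter_upwards [hG, Iio_mem_nhds (show (0 : ℝ≥0) < 1 from one_pos)] with h h1 h2
    have h2' : (h : ℝ) ≤ 1 := by exact_mod_cast (le_of_lt h2)
    calc ‖G h - 1‖ = ‖(G h - 1 + ((h : ℝ) : 𝕜) • W) - ((h : ℝ) : 𝕜) • W‖ := by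
          rw [add_sub_cancel_right]
      _ ≤ C * (h : ℝ) ^ 2 + h * ‖W‖ := by
          refine (norm_sub_le _ _).trans (add_le_add h1 ?_)
          rw [norm_smul]; simp
      _ ≤ |C| * h + h * ‖W‖ := by
          gcongr
          · exact le_abs_self C
          · nlinarith [h.coe_nonneg]
      _ = c * h := by ring
  -- Consistency: the one-step error is $o(h)$, uniformly along the compact piece of orbit over
  -- $[0,t]$.
  have herr : ∀ ε > 0, ∀ᶠ h : ℝ≥0 in 𝓝 0, ∀ s ∈ Set.Icc 0 t,
      ‖S h (S s x) - (T h * G h) (S s x)‖ ≤ ε * h := by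
    intro ε hε
    refine isCompact_Icc.eventually_forall_of_forall_eventually fun s₀ _ => ?_
    -- The one-step error at $y$ is $hJ(h,y)$ up to $O(h^2)$, and $J(0,y)=Wy-Wy=0$.
    set J : ℝ≥0 × E → E := fun q => T q.1 (W q.2) - duhamelAverage T W S q.1 q.2 with hJ
    have hJc : Continuous J :=
      (hT.continuous_uncurry.comp (f := fun q : ℝ≥0 × E => (q.1, W q.2)) (by fun_prop)).sub
        (continuous_duhamelAverage hT hS W)
    have hSc : Continuous fun q : ℝ≥0 × ℝ≥0 => S q.2 x :=
      (hS.strong_continuous x).comp continuous_snd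
    have hlim : Tendsto (fun q : ℝ≥0 × ℝ≥0 => ‖J (q.1, S q.2 x)‖ +
        M * Real.exp (ω * q.1) * (|C| * q.1) * ‖S q.2 x‖) (𝓝 (0, s₀)) (𝓝 0) := by
      have : Continuous fun q : ℝ≥0 × ℝ≥0 => ‖J (q.1, S q.2 x)‖ +
          M * Real.exp (ω * q.1) * (|C| * q.1) * ‖S q.2 x‖ :=
        (hJc.comp (continuous_fst.prodMk hSc)).norm.add
          ((by fun_prop : Continuous fun q : ℝ≥0 × ℝ≥0 =>
            M * Real.exp (ω * q.1) * (|C| * q.1)).mul hSc.norm)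
      simpa [hJ, hT.map_zero_apply, duhamelAverage_zero hT hS] using this.tendsto (0, s₀)
    have hG' : ∀ᶠ q : ℝ≥0 × ℝ≥0 in 𝓝 (0, s₀),
        ‖G q.1 - 1 + ((q.1 : ℝ) : 𝕜) • W‖ ≤ C * (q.1 : ℝ) ^ 2 :=
      (continuous_fst.tendsto (0, s₀)).eventually hG
    filter_upwards [hlim.eventually (gt_mem_nhds hε), hG'] with q hq hGq
    obtain ⟨h, s⟩ := q
    simp only at hq hGq ⊢
    set y := S s x
    have e : S h y - (T h * G h) y = ((h : ℝ) : 𝕜) • J (h, y) -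
        T h ((G h - 1 + ((h : ℝ) : 𝕜) • W) y) := by
      rw [hd.apply_eq h y, mul_apply_eq_comp]
      simp only [hJ, smul_sub, add_apply, sub_apply, smul_apply, map_add, map_sub, map_smul,
        one_apply_eq_self]
      abel
    rw [e]
    calc _ ≤ ‖((h : ℝ) : 𝕜) • J (h, y)‖ + ‖T h ((G h - 1 + ((h : ℝ) : 𝕜) • W) y)‖ :=
          norm_sub_le _ _
      _ ≤ h * ‖J (h, y)‖ + (M * Real.exp (ω * h)) * ((|C| * (h : ℝ) ^ 2) * ‖y‖) := by
          refine add_le_add (by rw [norm_smul]; simp) ?_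
          refine (T h).le_of_opNorm_le_of_le (hM h) (ContinuousLinearMap.le_of_opNorm_le _ ?_ _)
          exact hGq.trans (by gcongr; exact le_abs_self C)
      _ = (‖J (h, y)‖ + M * Real.exp (ω * h) * (|C| * h) * ‖y‖) * h := by ring
      _ ≤ ε * h := by gcongr
  have hstep : Tendsto (fun k : ℕ => t / ((k : ℝ≥0) + 1)) atTop (𝓝 0) := by
    have h1 : Tendsto (fun k : ℕ => ((k + 1 : ℕ) : ℝ≥0)⁻¹) atTop (𝓝 0) :=
      (tendsto_add_atTop_iff_nat (f := fun k : ℕ => ((k : ℕ) : ℝ≥0)⁻¹) 1).2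
        (tendsto_inv_atTop_nhds_zero_nat (𝕜 := ℝ≥0))
    simpa [div_eq_mul_inv] using h1.const_mul t
  rw [tendsto_iff_norm_sub_tendsto_zero, Metric.tendsto_atTop']
  intro δ hδ
  set B : ℝ := M * Real.exp (t * (ω + M * c))
  have hBpos : 0 < B := by positivity
  -- Chosen so that the accumulated error $B\varepsilon t$ is at most $\delta/2$; the `+ 1` covers
  -- $t=0$.
  set ε : ℝ := δ / (2 * (B * (t + 1)))
  have hε : 0 < ε := by positivity
  have hev := (hstep.eventually (hG1.and (herr ε hε)))
  obtain ⟨N, hN⟩ := eventually_atTop.1 hev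
  refine ⟨N, fun k hk => ?_⟩
  obtain ⟨h1, h2⟩ := hN k hk.le
  set h : ℝ≥0 := t / (k + 1)
  have hh : ((k + 1 : ℕ) : ℝ≥0) * h = t := by
    push_cast; exact mul_div_cancel₀ _ (by positivity)
  have hh' : ((k + 1 : ℕ) : ℝ) * h = t := by exact_mod_cast hh
  have hpow : ∀ j ≤ k + 1, ‖(T h * G h) ^ j‖ ≤ B := by
    intro j hj
    have := norm_comp_pow_le hT hM0 hM h1 j 0
    simp only [hT.map_zero, ← ContinuousLinearMap.one_def, one_mul, NNReal.coe_zero, mul_zero,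
      Real.exp_zero, mul_one] at this
    refine this.trans ?_
    simp only [B]
    gcongr
    rw [← hh']
    gcongr
  have hle := norm_semigroup_sub_pow_le hS (N := k + 1) (x := x) hpow (ε := ε * h) (fun j hj => by
    refine h2 _ ⟨zero_le, ?_⟩
    rw [← hh]
    gcongr)
  rw [hh] at hle
  rw [dist_zero_right, norm_norm, norm_sub_rev]
  refine hle.trans_lt ?_
  calc ((k + 1 : ℕ) : ℝ) * (B * (ε * h)) = B * ε * (((k + 1 : ℕ) : ℝ) * h) := by ring
    _ = B * ε * t := by rw [hh']
    _ ≤ B * ε * (t + 1) := by gcongr; linarith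
    _ = δ / 2 := by simp only [ε]; field_simp
    _ < δ := by linarith

end Trotter

/-! ### Order and monotone convergence in $L_p$ over $\mathbb R$ or $\mathbb C$. -/

section LpOrder

open scoped ComplexOrder

variable {Ω 𝕜 : Type*} [MeasurableSpace Ω] [RCLike 𝕜] {μ : Measure Ω} {p : ℝ≥0∞}

theorem RCLike.nonneg_iff_exists_nnreal {z : 𝕜} : 0 ≤ z ↔ ∃ r : ℝ≥0, z = ((r : ℝ) : 𝕜) := by
  rw [RCLike.nonneg_iff_exists_ofReal]
  exact ⟨fun ⟨x, hx, h⟩ => ⟨⟨x, hx⟩, h.symm⟩, fun ⟨r, h⟩ => ⟨r, r.2, h.symm⟩⟩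

theorem RCLike.norm_le_norm_of_nonneg_of_le {z w : 𝕜} (hz : 0 ≤ z) (h : z ≤ w) : ‖z‖ ≤ ‖w‖ := by
  have h1 := RCLike.norm_of_nonneg' hz
  have h2 := RCLike.norm_of_nonneg' (hz.trans h)
  rwa [← h1, ← h2, RCLike.ofReal_le_ofReal] at h

theorem lp_nonneg_iff_exists_nnreal {f : Lp 𝕜 p μ} :
    0 ≤ f ↔ ∀ᵐ ω ∂μ, ∃ r : ℝ≥0, f ω = ((r : ℝ) : 𝕜) := by
  rw [← Lp.coeFn_nonneg]
  exact eventually_congr (Eventually.of_forall fun ω => RCLike.nonneg_iff_exists_nnreal)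

theorem isPositiveLpOperator_iff [Fact (1 ≤ p)] {B : Lp 𝕜 p μ →L[𝕜] Lp 𝕜 p μ} :
    IsPositiveLpOperator B ↔ ∀ f, 0 ≤ f → 0 ≤ B f := by
  simp only [IsPositiveLpOperator, lp_nonneg_iff_exists_nnreal]

theorem lp_ae_nonneg {f : Lp 𝕜 p μ} (hf : 0 ≤ f) : ∀ᵐ ω ∂μ, 0 ≤ f ω := (Lp.coeFn_nonneg f).2 hf

theorem lp_norm_le_norm_of_nonneg_of_le {f g : Lp 𝕜 p μ} (hf : 0 ≤ f) (h : f ≤ g) :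
    ‖f‖ ≤ ‖g‖ := by
  refine Lp.norm_le_norm_of_ae_le ?_
  filter_upwards [lp_ae_nonneg hf, (Lp.coeFn_le f g).2 h] with ω h1 h2
  exact RCLike.norm_le_norm_of_nonneg_of_le h1 h2

theorem lp_tendsto_of_le_of_le [Fact (1 ≤ p)] {ι : Type*} {l : Filter ι} {a b c : ι → Lp 𝕜 p μ}
    {x : Lp 𝕜 p μ} (ha : Tendsto a l (𝓝 x)) (hc : Tendsto c l (𝓝 x))
    (hab : ∀ᶠ i in l, a i ≤ b i) (hbc : ∀ᶠ i in l, b i ≤ c i) : Tendsto b l (𝓝 x) := by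
  have h1 : Tendsto (fun i => ‖c i - a i‖) l (𝓝 0) := by simpa using (hc.sub ha).norm
  have h2 : Tendsto (fun i => b i - a i) l (𝓝 0) := by
    refine squeeze_zero_norm' ?_ h1
    filter_upwards [hab, hbc] with i hi hi'
    exact lp_norm_le_norm_of_nonneg_of_le (sub_nonneg.2 hi) (sub_le_sub_right hi' _)
  simpa using h2.add ha

/-- Pointwise $a^p+b^p\le(a+b)^p$, integrated. For a decreasing sequence it gives
$\|f_N-f_n\|^p\le\|f_N\|^p-\|f_n\|^p$, hence the Cauchy property. -/
theorem lp_norm_rpow_add_le [Fact (1 ≤ p)] (hp : p ≠ ∞) {f g : Lp 𝕜 p μ} (hf : 0 ≤ f)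
    (hg : 0 ≤ g) : ‖f‖ ^ p.toReal + ‖g‖ ^ p.toReal ≤ ‖f + g‖ ^ p.toReal := by
  have hp1 : 1 ≤ p := Fact.out
  have hp0 : p ≠ 0 := (zero_lt_one.trans_le hp1).ne'
  have hr : 1 ≤ p.toReal := by
    rw [← ENNReal.toReal_one]; exact ENNReal.toReal_mono hp hp1
  have hn : ∀ u : Lp 𝕜 p μ, ENNReal.ofReal (‖u‖ ^ p.toReal) = ∫⁻ ω, ‖u ω‖ₑ ^ p.toReal ∂μ := by
    intro u
    rw [← ENNReal.ofReal_rpow_of_nonneg (norm_nonneg _) ENNReal.toReal_nonneg, Lp.norm_def,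
      ENNReal.ofReal_toReal (Lp.eLpNorm_ne_top u), eLpNorm_eq_lintegral_rpow_enorm_toReal hp0 hp,
      ← ENNReal.rpow_mul, one_div, inv_mul_cancel₀ (by positivity), ENNReal.rpow_one]
  rw [← ENNReal.ofReal_le_ofReal_iff (by positivity), ENNReal.ofReal_add (by positivity)
    (by positivity), hn, hn, hn, ← lintegral_add_left'
      ((Lp.aestronglyMeasurable f).enorm.pow_const _)]
  refine lintegral_mono_ae ?_
  filter_upwards [lp_ae_nonneg hf, lp_ae_nonneg hg, Lp.coeFn_add f g] with ω h1 h2 h3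
  rw [h3, Pi.add_apply]
  refine (ENNReal.add_rpow_le_rpow_add _ _ hr).trans ?_
  gcongr
  obtain ⟨r, hr⟩ := RCLike.nonneg_iff_exists_nnreal.1 h1
  obtain ⟨s, hs⟩ := RCLike.nonneg_iff_exists_nnreal.1 h2
  rw [hr, hs, ← RCLike.ofReal_add, ← NNReal.coe_add]
  simp only [← ofReal_norm, RCLike.norm_ofReal, NNReal.abs_eq]
  rw [← ENNReal.ofReal_add r.coe_nonneg s.coe_nonneg, NNReal.coe_add]

theorem lp_exists_tendsto_of_antitone [Fact (1 ≤ p)] (hp : p ≠ ∞) {f : ℕ → Lp 𝕜 p μ}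
    (hf : Antitone f) (h0 : ∀ n, 0 ≤ f n) : ∃ x, Tendsto f atTop (𝓝 x) := by
  have hp1 : 1 ≤ p := Fact.out
  have hr : 0 < p.toReal := ENNReal.toReal_pos (zero_lt_one.trans_le hp1).ne' hp
  refine cauchySeq_tendsto_of_complete ?_
  set c : ℕ → ℝ := fun n => ‖f n‖ ^ p.toReal
  have hc : Antitone c := fun m n h =>
    Real.rpow_le_rpow (norm_nonneg _) (lp_norm_le_norm_of_nonneg_of_le (h0 n) (hf h)) hr.le
  obtain ⟨y, hy⟩ : ∃ y, Tendsto c atTop (𝓝 y) := ⟨_, tendsto_atTop_ciInf hc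
    ⟨0, by rintro _ ⟨n, rfl⟩; positivity⟩⟩
  rw [Metric.cauchySeq_iff']
  intro ε hε
  obtain ⟨N, hN⟩ := Metric.cauchySeq_iff'.1 hy.cauchySeq (ε ^ p.toReal) (by positivity)
  refine ⟨N, fun n hn => ?_⟩
  have h1 := lp_norm_rpow_add_le hp (sub_nonneg.2 (hf hn)) (h0 n)
  rw [sub_add_cancel] at h1
  have h2 := hN n hn
  rw [Real.dist_eq, abs_lt] at h2
  rw [dist_eq_norm, norm_sub_rev]
  refine lt_of_not_ge fun hlt => ?_
  have := Real.rpow_le_rpow hε.le hlt hr.le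
  simp only [c] at h2
  linarith [h2.1]

theorem lp_exists_tendsto_of_monotone [Fact (1 ≤ p)] (hp : p ≠ ∞) {f : ℕ → Lp 𝕜 p μ}
    (hf : Monotone f) {g : Lp 𝕜 p μ} (hg : ∀ n, f n ≤ g) : ∃ x, Tendsto f atTop (𝓝 x) := by
  obtain ⟨x, hx⟩ := lp_exists_tendsto_of_antitone hp (f := fun n => g - f n)
    (fun m n h => sub_le_sub_left (hf h) g) fun n => sub_nonneg.2 (hg n)
  exact ⟨g - x, by simpa using hx.const_sub g⟩

/-- A function on `ℝ` with values in `L_p` that is monotone (or antitone) converges at infinity if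
it converges along the naturals. -/
theorem lp_tendsto_atTop_real_of_monotone [Fact (1 ≤ p)] {f : ℝ → Lp 𝕜 p μ} {x : Lp 𝕜 p μ}
    (hf : MonotoneOn f (Set.Ici 0)) (h : Tendsto (fun n : ℕ => f n) atTop (𝓝 x)) :
    Tendsto f atTop (𝓝 x) := by
  refine lp_tendsto_of_le_of_le (h.comp (tendsto_nat_floor_atTop (α := ℝ)))
    (h.comp (tendsto_nat_ceil_atTop (α := ℝ))) ?_ ?_
  · filter_upwards [eventually_ge_atTop 0] with a ha
    exact hf (Set.mem_Ici.2 (Nat.cast_nonneg _)) ha (Nat.floor_le ha)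
  · filter_upwards [eventually_ge_atTop 0] with a ha
    exact hf ha (Set.mem_Ici.2 (Nat.cast_nonneg _)) (Nat.le_ceil a)

theorem lp_tendsto_atTop_real_of_antitone [Fact (1 ≤ p)] {f : ℝ → Lp 𝕜 p μ} {x : Lp 𝕜 p μ}
    (hf : AntitoneOn f (Set.Ici 0)) (h : Tendsto (fun n : ℕ => f n) atTop (𝓝 x)) :
    Tendsto f atTop (𝓝 x) := by
  have := lp_tendsto_atTop_real_of_monotone (f := fun a => -f a) hf.neg h.neg
  simpa using this.neg

/-- The real function `φ`, viewed in `L_p(𝕜)`. -/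
def lpOfReal (φ : Ω → ℝ) (h : MemLp φ p μ) : Lp 𝕜 p μ := (h.ofReal (K := 𝕜)).toLp _

theorem coeFn_lpOfReal {φ : Ω → ℝ} (h : MemLp φ p μ) :
    lpOfReal (𝕜 := 𝕜) φ h =ᵐ[μ] fun ω => (φ ω : 𝕜) := MemLp.coeFn_toLp _

theorem lpOfReal_nonneg {φ : Ω → ℝ} (h : MemLp φ p μ) (h0 : ∀ ω, 0 ≤ φ ω) :
    0 ≤ lpOfReal (𝕜 := 𝕜) φ h := by
  rw [← Lp.coeFn_nonneg]
  filter_upwards [coeFn_lpOfReal (𝕜 := 𝕜) h] with ω hω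
  rw [hω, Pi.zero_apply, RCLike.ofReal_nonneg]
  exact h0 ω

theorem lpOfReal_mem_span {φ : Ω → ℝ} (h : MemLp φ p μ) :
    lpOfReal φ h ∈ Submodule.span 𝕜 {f : Lp 𝕜 p μ | 0 ≤ f} := by
  have hn : MemLp (fun ω => max (-φ ω) 0) p μ := h.neg.pos_part
  have e : lpOfReal φ h =
      lpOfReal (𝕜 := 𝕜) (fun ω => max (φ ω) 0) h.pos_part - lpOfReal _ hn := by
    refine Lp.ext ?_
    filter_upwards [coeFn_lpOfReal (𝕜 := 𝕜) h, coeFn_lpOfReal (𝕜 := 𝕜) h.pos_part,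
      coeFn_lpOfReal (𝕜 := 𝕜) hn, Lp.coeFn_sub (lpOfReal (𝕜 := 𝕜) _ h.pos_part) (lpOfReal _ hn)]
      with ω h1 h2 h3 h4
    rw [h4, Pi.sub_apply, h1, h2, h3, ← RCLike.ofReal_sub]
    congr 1
    rcases le_total 0 (φ ω) with h | h
    · rw [max_eq_left h, max_eq_right (by linarith), sub_zero]
    · rw [max_eq_right h, max_eq_left (by linarith)]; ring
  rw [e]
  exact Submodule.sub_mem _ (Submodule.subset_span (lpOfReal_nonneg _ fun _ => le_max_right _ _))
    (Submodule.subset_span (lpOfReal_nonneg _ fun _ => le_max_right _ _))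

/-- Real and imaginary parts, each split into positive and negative part. Linear properties
therefore need checking only on the positive cone. -/
theorem span_lp_nonneg : Submodule.span 𝕜 {f : Lp 𝕜 p μ | 0 ≤ f} = ⊤ := by
  refine eq_top_iff.2 fun f _ => ?_
  have hf := Lp.memLp f
  have e : f = lpOfReal (𝕜 := 𝕜) (fun ω => RCLike.re (f ω)) hf.re + (RCLike.I : 𝕜) • lpOfReal (𝕜 := 𝕜) (fun ω => RCLike.im (f ω)) hf.im := by
    refine Lp.ext ?_
    filter_upwards [coeFn_lpOfReal (𝕜 := 𝕜) hf.re, coeFn_lpOfReal (𝕜 := 𝕜) hf.im,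
      Lp.coeFn_add (lpOfReal (𝕜 := 𝕜) (fun ω => RCLike.re (f ω)) hf.re) ((RCLike.I : 𝕜) • lpOfReal (𝕜 := 𝕜) (fun ω => RCLike.im (f ω)) hf.im),
      Lp.coeFn_smul (RCLike.I : 𝕜) (lpOfReal (𝕜 := 𝕜) (fun ω => RCLike.im (f ω)) hf.im)] with ω h1 h2 h3 h4
    rw [h3, Pi.add_apply, h4, Pi.smul_apply, h1, h2, smul_eq_mul, mul_comm, RCLike.re_add_im]
  rw [e]
  exact Submodule.add_mem _ (lpOfReal_mem_span _) (Submodule.smul_mem _ _ (lpOfReal_mem_span _))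

theorem lp_induction_nonneg {P : Lp 𝕜 p μ → Prop} (hnn : ∀ f, 0 ≤ f → P f)
    (hadd : ∀ f g, P f → P g → P (f + g)) (hsmul : ∀ (c : 𝕜) f, P f → P (c • f)) (f : Lp 𝕜 p μ) :
    P f :=
  Submodule.span_induction (p := fun f _ => P f) (s := {f : Lp 𝕜 p μ | 0 ≤ f}) hnn (hnn 0 le_rfl)
    (fun f g _ _ => hadd f g) (fun c f _ => hsmul c f)
    (by rw [span_lp_nonneg]; exact Submodule.mem_top)

end LpOrder

/-! ### Multiplication operators. -/

section Multiplication

variable {Ω 𝕜 : Type*} [MeasurableSpace Ω] [RCLike 𝕜] {μ : Measure Ω} {p : ℝ≥0∞}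

/-- Bounded measurable real functions. -/
def IsBddMeasurable (φ : Ω → ℝ) : Prop := Measurable φ ∧ ∃ C, ∀ ω, |φ ω| ≤ C

theorem memLp_ofReal_mul {φ : Ω → ℝ} (hφ : Measurable φ) {C : ℝ} (hC : ∀ ω, |φ ω| ≤ C)
    (f : Lp 𝕜 p μ) : MemLp (fun ω => (φ ω : 𝕜) * f ω) p μ := by
  refine MemLp.of_le_mul (c := C) (Lp.memLp f) ?_ (Eventually.of_forall fun ω => ?_)
  · exact (RCLike.continuous_ofReal.measurable.comp hφ).aestronglyMeasurable.mul
      (Lp.aestronglyMeasurable f)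
  · rw [norm_mul, RCLike.norm_ofReal]
    exact mul_le_mul_of_nonneg_right (hC ω) (norm_nonneg _)

open Classical in
/-- Multiplication by a bounded measurable real function (`0` for other functions). -/
def mulLp [Fact (1 ≤ p)] (φ : Ω → ℝ) : Lp 𝕜 p μ →L[𝕜] Lp 𝕜 p μ :=
  if h : IsBddMeasurable φ then
    LinearMap.mkContinuous
      { toFun := fun f => (memLp_ofReal_mul h.1 h.2.choose_spec f).toLp _
        map_add' := fun f g => by
          rw [← MemLp.toLp_add, MemLp.toLp_eq_toLp_iff]
          filter_upwards [Lp.coeFn_add f g] with ω hω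
          rw [hω, Pi.add_apply, mul_add, Pi.add_apply]
        map_smul' := fun c f => by
          rw [RingHom.id_apply, ← MemLp.toLp_const_smul, MemLp.toLp_eq_toLp_iff]
          filter_upwards [Lp.coeFn_smul c f] with ω hω
          rw [hω, Pi.smul_apply, Pi.smul_apply, smul_eq_mul, smul_eq_mul, mul_left_comm] }
      h.2.choose fun f => Lp.norm_le_mul_norm_of_ae_le_mul (by
        filter_upwards [(memLp_ofReal_mul h.1 h.2.choose_spec f).coeFn_toLp] with ω hω
        simp only [LinearMap.coe_mk, AddHom.coe_mk]
        rw [hω, norm_mul, RCLike.norm_ofReal]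
        exact mul_le_mul_of_nonneg_right (h.2.choose_spec ω) (norm_nonneg _))
  else 0

variable [Fact (1 ≤ p)]

theorem coeFn_mulLp {φ : Ω → ℝ} (h : IsBddMeasurable φ) (f : Lp 𝕜 p μ) :
    mulLp φ f =ᵐ[μ] fun ω => (φ ω : 𝕜) * f ω := by
  rw [mulLp, dif_pos h]
  exact (memLp_ofReal_mul h.1 h.2.choose_spec f).coeFn_toLp

theorem IsBddMeasurable.const_mul {φ : Ω → ℝ} (h : IsBddMeasurable φ) (c : ℝ) :
    IsBddMeasurable fun ω => c * φ ω := by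
  obtain ⟨hm, C, hC⟩ := h
  refine ⟨hm.const_mul c, |c| * C, fun ω => ?_⟩
  rw [abs_mul]; gcongr; exact hC ω

theorem IsBddMeasurable.add {φ ψ : Ω → ℝ} (h : IsBddMeasurable φ) (h' : IsBddMeasurable ψ) :
    IsBddMeasurable fun ω => φ ω + ψ ω := by
  obtain ⟨hm, C, hC⟩ := h
  obtain ⟨hm', C', hC'⟩ := h'
  exact ⟨hm.add hm', C + C', fun ω => (abs_add_le _ _).trans (add_le_add (hC ω) (hC' ω))⟩

theorem IsBddMeasurable.exp_neg {φ : Ω → ℝ} (h : IsBddMeasurable φ) (t : ℝ≥0) :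
    IsBddMeasurable fun ω => Real.exp (-(t * φ ω)) := by
  obtain ⟨hm, C, hC⟩ := h.const_mul t
  refine ⟨hm.neg.exp, Real.exp C, fun ω => ?_⟩
  rw [abs_of_pos (Real.exp_pos _)]
  exact Real.exp_le_exp.2 ((neg_le_abs _).trans (hC ω))

/-- Comes from $|e^x-1-x|\le x^2$ for $|x|\le1$; it is the hypothesis on `G` in the Trotter formula.
-/
theorem IsBddMeasurable.eventually_norm_mulLp_exp_neg_le {φ : Ω → ℝ} (h : IsBddMeasurable φ) :
    ∃ C : ℝ, ∀ᶠ t : ℝ≥0 in 𝓝 0,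
      ‖(mulLp fun ω => Real.exp (-(t * φ ω)) : Lp 𝕜 p μ →L[𝕜] Lp 𝕜 p μ) - 1 +
        ((t : ℝ) : 𝕜) • mulLp φ‖ ≤ C * (t : ℝ) ^ 2 := by
  obtain ⟨hm, C, hC⟩ := h
  have h : IsBddMeasurable φ := ⟨hm, C, hC⟩
  refine ⟨C ^ 2, ?_⟩
  have hlim : Tendsto (fun t : ℝ≥0 => (t : ℝ) * C) (𝓝 0) (𝓝 0) := by
    have : Continuous fun t : ℝ≥0 => (t : ℝ) * C := by fun_prop
    simpa using this.tendsto 0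
  filter_upwards [hlim.eventually (gt_mem_nhds one_pos)] with t ht
  refine ContinuousLinearMap.opNorm_le_bound _ (by positivity) fun f =>
    Lp.norm_le_mul_norm_of_ae_le_mul ?_
  simp only [add_apply, sub_apply, smul_apply, one_apply_eq_self]
  filter_upwards [coeFn_mulLp h f, coeFn_mulLp (h.exp_neg t) f,
    Lp.coeFn_add (mulLp (fun ω => Real.exp (-(t * φ ω))) f - f) (((t : ℝ) : 𝕜) • mulLp φ f),
    Lp.coeFn_sub (mulLp (fun ω => Real.exp (-(t * φ ω))) f) f,
    Lp.coeFn_smul ((t : ℝ) : 𝕜) (mulLp φ f)] with ω h1 h2 h3 h4 h5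
  rw [h3, Pi.add_apply, h4, Pi.sub_apply, h5, Pi.smul_apply, h1, h2, smul_eq_mul]
  have e : ((Real.exp (-(t * φ ω)) : ℝ) : 𝕜) * f ω - f ω + ((t : ℝ) : 𝕜) * ((φ ω : 𝕜) * f ω) =
      ((Real.exp (-(t * φ ω)) - 1 - (-(t * φ ω)) : ℝ) : 𝕜) * f ω := by
    push_cast; ring
  rw [e, norm_mul, RCLike.norm_ofReal]
  gcongr
  have hle : |(-(t * φ ω) : ℝ)| ≤ t * C := by
    rw [abs_neg, abs_mul, NNReal.abs_eq]; gcongr; exact hC ω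
  refine (Real.abs_exp_sub_one_sub_id_le (hle.trans ht.le)).trans ?_
  rw [← sq_abs]
  calc _ ≤ (t * C) ^ 2 := by gcongr
    _ = _ := by ring

end Multiplication

/-! ### Bounded potentials: existence, uniqueness and product formula for $T_W$. -/

section BoundedPerturbation

variable {Ω 𝕜 : Type*} [MeasurableSpace Ω] [RCLike 𝕜] {μ : Measure Ω} {p : ℝ≥0∞} [Fact (1 ≤ p)]
  {T : ℝ≥0 → Lp 𝕜 p μ →L[𝕜] Lp 𝕜 p μ} {W : Ω → ℝ}

theorem exists_isGeneratedBySub (hT : IsC0Semigroup T) (hW : IsBddMeasurable W) :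
    ∃ S, IsGeneratedBySub T W S ∧ IsDuhamelPerturbation T (mulLp W) S := by
  obtain ⟨S, hS, hd⟩ := exists_duhamel hT (mulLp W)
  refine ⟨S, ⟨hS, fun f g => ?_⟩, hd⟩
  rw [hd.inGenerator_iff hT hS]
  constructor
  · intro h
    exact ⟨_, mulLp W f, h, coeFn_mulLp hW f, by abel⟩
  · rintro ⟨g₀, w, h, hw, rfl⟩
    have : w = mulLp W f := Lp.ext (hw.trans (coeFn_mulLp hW f).symm)
    rwa [← this, sub_add_cancel]

theorem isGeneratedBySub_boundedPerturbation (hT : IsC0Semigroup T) (hW : IsBddMeasurable W) :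
    IsGeneratedBySub T W (boundedPerturbation T W) := by
  obtain ⟨S, hS, -⟩ := exists_isGeneratedBySub hT hW
  have h : ∃ S, IsGeneratedBySub T W S := ⟨S, hS⟩
  rw [boundedPerturbation, dif_pos h]
  exact h.choose_spec

theorem isC0Semigroup_boundedPerturbation (hT : IsC0Semigroup T) (hW : IsBddMeasurable W) :
    IsC0Semigroup (boundedPerturbation T W) := (isGeneratedBySub_boundedPerturbation hT hW).1

theorem IsGeneratedBySub.unique {S S' : ℝ≥0 → Lp 𝕜 p μ →L[𝕜] Lp 𝕜 p μ}
    (h : IsGeneratedBySub T W S) (h' : IsGeneratedBySub T W S') : S = S' :=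
  h.1.eq_of_inGenerator_le h'.1 fun f g hfg => (h'.2 f g).2 ((h.2 f g).1 hfg)

/-- Lets $T$ itself enter comparisons as the case of potential zero. -/
theorem boundedPerturbation_zero (hT : IsC0Semigroup T) :
    boundedPerturbation T (fun _ => 0) = T := by
  have h0 : IsBddMeasurable (fun _ : Ω => (0 : ℝ)) := ⟨measurable_const, 0, by simp⟩
  refine (isGeneratedBySub_boundedPerturbation hT h0).unique ⟨hT, fun f g => ?_⟩
  constructor
  · intro h
    refine ⟨g, 0, h, ?_, (sub_zero g).symm⟩
    filter_upwards [Lp.coeFn_zero 𝕜 p μ] with ω hω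
    rw [hω, Pi.zero_apply, RCLike.ofReal_zero, zero_mul]
  · rintro ⟨g₀, w, h, hw, rfl⟩
    have : w = 0 := Lp.ext (by
      filter_upwards [Lp.coeFn_zero 𝕜 p μ, hw] with ω h1 h2
      rw [h1, h2, Pi.zero_apply, RCLike.ofReal_zero, zero_mul])
    rwa [this, sub_zero]

/-- One factor of the Trotter product. -/
def trotterStep (T : ℝ≥0 → Lp 𝕜 p μ →L[𝕜] Lp 𝕜 p μ) (W : Ω → ℝ) (h : ℝ≥0) :
    Lp 𝕜 p μ →L[𝕜] Lp 𝕜 p μ := T h * mulLp fun ω => Real.exp (-(h * W ω))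

theorem tendsto_trotterStep_pow (hT : IsC0Semigroup T) (hW : IsBddMeasurable W) (t : ℝ≥0)
    (f : Lp 𝕜 p μ) :
    Tendsto (fun k : ℕ => (trotterStep T W (t / (k + 1)) ^ (k + 1)) f) atTop
      (𝓝 (boundedPerturbation T W t f)) := by
  obtain ⟨S, hS, hd⟩ := exists_isGeneratedBySub hT hW
  rw [(isGeneratedBySub_boundedPerturbation hT hW).unique hS]
  obtain ⟨C, hC⟩ := hW.eventually_norm_mulLp_exp_neg_le (𝕜 := 𝕜) (p := p) (μ := μ)
  exact hd.tendsto_pow hT hS.1 hC t f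

end BoundedPerturbation

/-! ### Positivity and monotone dependence on the potential. -/

section OperatorOrder

open scoped ComplexOrder

variable {Ω 𝕜 : Type*} [MeasurableSpace Ω] [RCLike 𝕜] {μ : Measure Ω} {p : ℝ≥0∞} [Fact (1 ≤ p)]

theorem IsPositiveLpOperator.apply_nonneg {B : Lp 𝕜 p μ →L[𝕜] Lp 𝕜 p μ}
    (hB : IsPositiveLpOperator B) {f : Lp 𝕜 p μ} (hf : 0 ≤ f) : 0 ≤ B f :=
  isPositiveLpOperator_iff.1 hB f hf

theorem IsPositiveLpOperator.mono {B : Lp 𝕜 p μ →L[𝕜] Lp 𝕜 p μ} (hB : IsPositiveLpOperator B)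
    {f g : Lp 𝕜 p μ} (h : f ≤ g) : B f ≤ B g := by
  have := hB.apply_nonneg (sub_nonneg.2 h)
  rwa [map_sub, sub_nonneg] at this

theorem IsPositiveLpOperator.mul {A B : Lp 𝕜 p μ →L[𝕜] Lp 𝕜 p μ} (hA : IsPositiveLpOperator A)
    (hB : IsPositiveLpOperator B) : IsPositiveLpOperator (A * B) :=
  isPositiveLpOperator_iff.2 fun _ hf => hA.apply_nonneg (hB.apply_nonneg hf)

theorem IsPositiveLpOperator.pow {A : Lp 𝕜 p μ →L[𝕜] Lp 𝕜 p μ} (hA : IsPositiveLpOperator A)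
    (k : ℕ) : IsPositiveLpOperator (A ^ k) := by
  induction k with
  | zero => exact isPositiveLpOperator_iff.2 fun f hf => hf
  | succ k ih => rw [pow_succ]; exact ih.mul hA

theorem isPositiveLpOperator_mulLp {φ : Ω → ℝ} (h : IsBddMeasurable φ) (h0 : ∀ ω, 0 ≤ φ ω) :
    IsPositiveLpOperator (mulLp φ : Lp 𝕜 p μ →L[𝕜] Lp 𝕜 p μ) := by
  refine isPositiveLpOperator_iff.2 fun f hf => ?_
  rw [← Lp.coeFn_nonneg]
  filter_upwards [coeFn_mulLp h f, lp_ae_nonneg hf] with ω h1 h2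
  rw [h1]
  exact mul_nonneg (RCLike.ofReal_nonneg.2 (h0 ω)) h2

/-- `A f ≤ B f` for all `f ≥ 0`. -/
def LpOperatorLE (A B : Lp 𝕜 p μ →L[𝕜] Lp 𝕜 p μ) : Prop := ∀ f, 0 ≤ f → A f ≤ B f

theorem LpOperatorLE.pow {A B : Lp 𝕜 p μ →L[𝕜] Lp 𝕜 p μ} (hA : IsPositiveLpOperator A)
    (hAB : LpOperatorLE A B) (k : ℕ) : LpOperatorLE (A ^ k) (B ^ k) := by
  have hB : IsPositiveLpOperator B := isPositiveLpOperator_iff.2 fun f hf =>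
    (hA.apply_nonneg hf).trans (hAB f hf)
  induction k with
  | zero => exact fun f _ => le_rfl
  | succ k ih =>
    intro f hf
    rw [pow_succ', pow_succ', mul_apply_eq_comp, mul_apply_eq_comp]
    exact (hAB _ ((hA.pow k).apply_nonneg hf)).trans (hB.mono (ih f hf))

/-- Domination of differences of positive operators passes to powers. -/
theorem lpOperatorLE_pow_sub_pow {A A' B B' : Lp 𝕜 p μ →L[𝕜] Lp 𝕜 p μ}
    (hA : IsPositiveLpOperator A)
    (hB' : IsPositiveLpOperator B') (hAA : LpOperatorLE A' A) (hBB : LpOperatorLE B' B)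
    (hBA : LpOperatorLE B' A') (hd : LpOperatorLE (A' - B') (A - B)) (k : ℕ) :
    LpOperatorLE (A' ^ k - B' ^ k) (A ^ k - B ^ k) := by
  have hB : IsPositiveLpOperator B := isPositiveLpOperator_iff.2 fun f hf =>
    (hB'.apply_nonneg hf).trans (hBB f hf)
  have hAB' : IsPositiveLpOperator (A' - B') := isPositiveLpOperator_iff.2 fun f hf =>
    sub_nonneg.2 (hBA f hf)
  induction k with
  | zero => intro f _; simp
  | succ k ih =>
    intro f hf
    -- With this splitting every factor on the primed side is positive and dominated by its unprimed
    -- counterpart.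
    have e : ∀ A B : Lp 𝕜 p μ →L[𝕜] Lp 𝕜 p μ, (A ^ (k + 1) - B ^ (k + 1)) f =
        A ((A ^ k - B ^ k) f) + (A - B) ((B ^ k) f) := fun A B => by
      simp only [pow_succ', sub_apply, mul_apply_eq_comp, map_sub]; abel
    rw [e, e]
    refine add_le_add ?_ ?_
    · exact (hAA _ (sub_nonneg.2 (hBA.pow hB' k f hf))).trans (hA.mono (ih f hf))
    · exact (hAB'.mono (hBB.pow hB' k f hf)).trans (hd _ ((hB.pow k).apply_nonneg hf))

variable {T : ℝ≥0 → Lp 𝕜 p μ →L[𝕜] Lp 𝕜 p μ} {U W W' : Ω → ℝ}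

theorem isPositiveLpOperator_trotterStep (hTpos : ∀ t, IsPositiveLpOperator (T t))
    (hW : IsBddMeasurable W) (h : ℝ≥0) : IsPositiveLpOperator (trotterStep T W h) :=
  (hTpos h).mul (isPositiveLpOperator_mulLp (hW.exp_neg h) fun _ => (Real.exp_pos _).le)

theorem trotterStep_le (hTpos : ∀ t, IsPositiveLpOperator (T t)) (hW : IsBddMeasurable W)
    (hW' : IsBddMeasurable W') (hle : ∀ ω, W ω ≤ W' ω) (h : ℝ≥0) :
    LpOperatorLE (trotterStep T W' h) (trotterStep T W h) := by
  intro f hf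
  refine (hTpos h).mono (f := mulLp (fun ω => Real.exp (-(h * W' ω))) f)
    (g := mulLp (fun ω => Real.exp (-(h * W ω))) f) ?_
  rw [← Lp.coeFn_le]
  filter_upwards [coeFn_mulLp (hW.exp_neg h) f, coeFn_mulLp (hW'.exp_neg h) f, lp_ae_nonneg hf]
    with ω h1 h2 h3
  rw [h1, h2]
  refine mul_le_mul_of_nonneg_right (RCLike.ofReal_le_ofReal.2 (Real.exp_le_exp.2 ?_)) h3
  exact neg_le_neg (mul_le_mul_of_nonneg_left (hle ω) h.coe_nonneg)

/-- Adding `U` multiplies the difference of exponentials by $e^{-hU}\le1$. -/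
theorem trotterStep_sub_le (hTpos : ∀ t, IsPositiveLpOperator (T t)) (hU : IsBddMeasurable U)
    (hU0 : ∀ ω, 0 ≤ U ω) (hW : IsBddMeasurable W) (hW' : IsBddMeasurable W')
    (hle : ∀ ω, W ω ≤ W' ω) (h : ℝ≥0) :
    LpOperatorLE (trotterStep T (fun ω => U ω + W ω) h - trotterStep T (fun ω => U ω + W' ω) h)
      (trotterStep T W h - trotterStep T W' h) := by
  intro f hf
  simp only [trotterStep, sub_apply, mul_apply_eq_comp, ← map_sub]
  refine (hTpos h).mono ?_
  rw [← Lp.coeFn_le]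
  set E : (Ω → ℝ) → Lp 𝕜 p μ := fun φ => mulLp (fun ω => Real.exp (-(h * φ ω))) f
  have hE : ∀ φ : Ω → ℝ, E φ = mulLp (fun ω => Real.exp (-(h * φ ω))) f := fun _ => rfl
  simp only [← hE]
  filter_upwards [coeFn_mulLp (hW.exp_neg h) f, coeFn_mulLp (hW'.exp_neg h) f,
    coeFn_mulLp ((hU.add hW).exp_neg h) f, coeFn_mulLp ((hU.add hW').exp_neg h) f,
    Lp.coeFn_sub (E W) (E W'), Lp.coeFn_sub (E fun ω => U ω + W ω) (E fun ω => U ω + W' ω),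
    lp_ae_nonneg hf] with ω h1 h2 h3 h4 h5 h6 h7
  rw [h5, h6, Pi.sub_apply, Pi.sub_apply, hE, hE, hE, hE, h1, h2, h3, h4, ← sub_mul, ← sub_mul,
    ← RCLike.ofReal_sub, ← RCLike.ofReal_sub]
  refine mul_le_mul_of_nonneg_right (RCLike.ofReal_le_ofReal.2 ?_) h7
  have e : ∀ φ : Ω → ℝ, Real.exp (-(h * (U ω + φ ω))) =
      Real.exp (-(h * U ω)) * Real.exp (-(h * φ ω)) := fun φ => by
    rw [← Real.exp_add]; ring_nf
  rw [e, e, ← mul_sub]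
  refine mul_le_of_le_one_left (sub_nonneg.2 (Real.exp_le_exp.2 ?_)) (Real.exp_le_one_iff.2 ?_)
  · exact neg_le_neg (mul_le_mul_of_nonneg_left (hle ω) h.coe_nonneg)
  · exact neg_nonpos.2 (mul_nonneg h.coe_nonneg (hU0 ω))

theorem isPositiveLpOperator_boundedPerturbation (hT : IsC0Semigroup T)
    (hTpos : ∀ t, IsPositiveLpOperator (T t)) (hW : IsBddMeasurable W) (t : ℝ≥0) :
    IsPositiveLpOperator (boundedPerturbation T W t) :=
  isPositiveLpOperator_iff.2 fun f hf => ge_of_tendsto' (tendsto_trotterStep_pow hT hW t f)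
    fun _ => ((isPositiveLpOperator_trotterStep hTpos hW _).pow _).apply_nonneg hf

theorem boundedPerturbation_le (hT : IsC0Semigroup T) (hTpos : ∀ t, IsPositiveLpOperator (T t))
    (hW : IsBddMeasurable W) (hW' : IsBddMeasurable W') (hle : ∀ ω, W ω ≤ W' ω) (t : ℝ≥0) :
    LpOperatorLE (boundedPerturbation T W' t) (boundedPerturbation T W t) := fun f hf =>
  le_of_tendsto_of_tendsto' (tendsto_trotterStep_pow hT hW' t f) (tendsto_trotterStep_pow hT hW t f)
    fun _ => (trotterStep_le hTpos hW hW' hle _).pow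
      (isPositiveLpOperator_trotterStep hTpos hW' _) _ f hf

/-- A nonnegative extra potential only shrinks the effect of changing `W` to `W'`. This gives
estimates for the negative part that are uniform in the cut-off of the positive part. -/
theorem boundedPerturbation_sub_le (hT : IsC0Semigroup T)
    (hTpos : ∀ t, IsPositiveLpOperator (T t)) (hU : IsBddMeasurable U)
    (hU0 : ∀ ω, 0 ≤ U ω) (hW : IsBddMeasurable W) (hW' : IsBddMeasurable W')
    (hle : ∀ ω, W ω ≤ W' ω) (t : ℝ≥0) {f : Lp 𝕜 p μ} (hf : 0 ≤ f) :
    boundedPerturbation T (fun ω => U ω + W ω) t f - boundedPerturbation T (fun ω => U ω + W' ω) t f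
      ≤ boundedPerturbation T W t f - boundedPerturbation T W' t f :=
  le_of_tendsto_of_tendsto'
    ((tendsto_trotterStep_pow hT (hU.add hW) t f).sub (tendsto_trotterStep_pow hT (hU.add hW') t f))
    ((tendsto_trotterStep_pow hT hW t f).sub (tendsto_trotterStep_pow hT hW' t f))
    fun _ => lpOperatorLE_pow_sub_pow (isPositiveLpOperator_trotterStep hTpos hW _)
      (isPositiveLpOperator_trotterStep hTpos (hU.add hW') _)
      (trotterStep_le hTpos hW (hU.add hW) (fun ω => le_add_of_nonneg_left (hU0 ω)) _)
      (trotterStep_le hTpos hW' (hU.add hW') (fun ω => le_add_of_nonneg_left (hU0 ω)) _)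
      (trotterStep_le hTpos (hU.add hW) (hU.add hW') (fun ω => add_le_add_right (hle ω) _) _)
      (trotterStep_sub_le hTpos hU hU0 hW hW' hle _) _ f hf

end OperatorOrder

/-! ### Pointwise Hölder inequality for positive operators and for $T_{\theta W}$. -/

section GeometricMean

open scoped ComplexOrder

variable {Ω 𝕜 : Type*} [MeasurableSpace Ω] [RCLike 𝕜] {μ : Measure Ω} {p : ℝ≥0∞} [Fact (1 ≤ p)]


/-- Young's inequality with a free parameter characterizes weighted geometric means. -/
theorem le_rpow_mul_rpow_of_forall_young {θ x a b : ℝ} (hθ : θ ∈ Set.Ioo (0 : ℝ) 1) (ha : 0 ≤ a)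
    (hb : 0 ≤ b)
    (h : ∀ c : ℚ, 0 < c → x ≤ (1 - θ) * (c : ℝ) ^ θ * a + θ * (c : ℝ) ^ (-(1 - θ)) * b) :
    x ≤ a ^ (1 - θ) * b ^ θ := by
  obtain ⟨hθ0, hθ1⟩ := hθ
  have hθ1' : 0 < 1 - θ := sub_pos.2 hθ1
  -- By continuity rational parameters suffice; in applications countably many parameters mean
  -- countably many null sets.
  have hreal : ∀ c : ℝ, 0 < c → x ≤ (1 - θ) * c ^ θ * a + θ * c ^ (-(1 - θ)) * b := by
    intro c hc
    by_contra! hlt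
    have hcont : ContinuousAt (fun c : ℝ => (1 - θ) * c ^ θ * a + θ * c ^ (-(1 - θ)) * b) c := by
      have h1 := Real.continuousAt_rpow_const c θ (Or.inl hc.ne')
      have h2 := Real.continuousAt_rpow_const c (-(1 - θ)) (Or.inl hc.ne')
      fun_prop
    have hev := (hcont.eventually (gt_mem_nhds hlt)).and (lt_mem_nhds hc)
    obtain ⟨l, u, ⟨hl, hu⟩, hsub⟩ := mem_nhds_iff_exists_Ioo_subset.1 hev
    obtain ⟨q, hq1, hq2⟩ := exists_rat_btwn (hl.trans hu)
    obtain ⟨h1, h2⟩ := hsub ⟨hq1, hq2⟩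
    exact absurd (h q (by exact_mod_cast h2)) (not_le.2 h1)
  rcases ha.eq_or_lt with rfl | ha
  · rw [Real.zero_rpow hθ1'.ne', zero_mul]
    have hlim : Tendsto (fun c : ℝ => θ * c ^ (-(1 - θ)) * b) atTop (𝓝 0) := by
      simpa using ((tendsto_rpow_neg_atTop hθ1').const_mul θ).mul_const b
    refine ge_of_tendsto hlim ?_
    filter_upwards [eventually_gt_atTop 0] with c hc
    simpa using hreal c hc
  rcases hb.eq_or_lt with rfl | hb
  · rw [Real.zero_rpow hθ0.ne', mul_zero]
    have hlim : Tendsto (fun c : ℝ => (1 - θ) * c ^ θ * a) (𝓝[>] 0) (𝓝 0) := by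
      have h1 : ContinuousAt (fun c : ℝ => c ^ θ) 0 :=
        Real.continuousAt_rpow_const 0 θ (Or.inr hθ0.le)
      have h2 := ((h1.tendsto.const_mul (1 - θ)).mul_const a).mono_left
        (nhdsWithin_le_nhds (s := Set.Ioi 0))
      simpa [Real.zero_rpow hθ0.ne'] using h2
    refine ge_of_tendsto hlim ?_
    filter_upwards [self_mem_nhdsWithin] with c hc
    simpa using hreal c hc
  -- `c = b / a` is the minimiser, with equality in Young's inequality. In the degenerate cases
  -- above, the infimum is a limit $c\to\infty$ or $c\to0$.
  · refine (hreal (b / a) (by positivity)).trans (le_of_eq ?_)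
    have e1 : (b / a) ^ θ * a = a ^ (1 - θ) * b ^ θ := by
      rw [Real.div_rpow hb.le ha.le, Real.rpow_sub ha, Real.rpow_one]; ring
    have e2 : (b / a) ^ (-(1 - θ)) * b = a ^ (1 - θ) * b ^ θ := by
      rw [Real.rpow_neg (by positivity), Real.div_rpow hb.le ha.le, Real.rpow_sub hb,
        Real.rpow_one]
      field_simp
    calc _ = (1 - θ) * ((b / a) ^ θ * a) + θ * ((b / a) ^ (-(1 - θ)) * b) := by ring
      _ = _ := by rw [e1, e2]; ring

theorem rpow_mul_rpow_le_young {θ a b c : ℝ} (hθ : θ ∈ Set.Ioo (0 : ℝ) 1) (ha : 0 ≤ a)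
    (hb : 0 ≤ b) (hc : 0 < c) :
    a ^ (1 - θ) * b ^ θ ≤ (1 - θ) * c ^ θ * a + θ * c ^ (-(1 - θ)) * b := by
  have h := Real.geom_mean_le_arith_mean2_weighted (sub_nonneg.2 hθ.2.le) hθ.1.le
    (mul_nonneg (Real.rpow_nonneg hc.le θ) ha)
    (mul_nonneg (Real.rpow_nonneg hc.le (-(1 - θ))) hb) (by ring)
  rw [Real.mul_rpow (by positivity) ha, Real.mul_rpow (by positivity) hb,
    ← Real.rpow_mul hc.le, ← Real.rpow_mul hc.le] at h
  have e : c ^ (θ * (1 - θ)) * c ^ (-(1 - θ) * θ) = 1 := by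
    rw [← Real.rpow_add hc, show θ * (1 - θ) + -(1 - θ) * θ = 0 by ring, Real.rpow_zero]
  calc _ = (c ^ (θ * (1 - θ)) * c ^ (-(1 - θ) * θ)) * (a ^ (1 - θ) * b ^ θ) := by rw [e, one_mul]
    _ = c ^ (θ * (1 - θ)) * a ^ (1 - θ) * (c ^ (-(1 - θ) * θ) * b ^ θ) := by ring
    _ ≤ _ := h
    _ = _ := by ring

/-- `|h|` is dominated by the weighted geometric mean of `|f|` and `|g|`. -/
def GeomMeanLE (θ : ℝ) (h f g : Lp 𝕜 p μ) : Prop :=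
  ∀ᵐ ω ∂μ, ‖h ω‖ ≤ ‖f ω‖ ^ (1 - θ) * ‖g ω‖ ^ θ

/-- Hölder's inequality for positive operators. -/
theorem IsPositiveLpOperator.geomMeanLE {B : Lp 𝕜 p μ →L[𝕜] Lp 𝕜 p μ}
    (hB : IsPositiveLpOperator B) {θ : ℝ} (hθ : θ ∈ Set.Ioo (0 : ℝ) 1) {h f g : Lp 𝕜 p μ}
    (hh : 0 ≤ h) (hf : 0 ≤ f) (hg : 0 ≤ g) (hle : GeomMeanLE θ h f g) :
    GeomMeanLE θ (B h) (B f) (B g) := by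
  have key : ∀ c : ℚ, 0 < c → ∀ᵐ ω ∂μ, ‖B h ω‖ ≤
      (1 - θ) * (c : ℝ) ^ θ * ‖B f ω‖ + θ * (c : ℝ) ^ (-(1 - θ)) * ‖B g ω‖ := by
    intro c hc
    have hc' : (0 : ℝ) < c := by exact_mod_cast hc
    set α : ℝ := (1 - θ) * (c : ℝ) ^ θ
    set β : ℝ := θ * (c : ℝ) ^ (-(1 - θ))
    have hα : 0 ≤ α := mul_nonneg (sub_nonneg.2 hθ.2.le) (Real.rpow_nonneg hc'.le _)
    have hβ : 0 ≤ β := mul_nonneg hθ.1.le (Real.rpow_nonneg hc'.le _)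
    -- Young's inequality replaces the geometric mean by a linear majorant, to which the positive
    -- operator `B` can be applied.
    have hl : h ≤ (α : 𝕜) • f + (β : 𝕜) • g := by
      rw [← Lp.coeFn_le]
      filter_upwards [hle, lp_ae_nonneg hh, lp_ae_nonneg hf, lp_ae_nonneg hg,
        Lp.coeFn_add ((α : 𝕜) • f) ((β : 𝕜) • g), Lp.coeFn_smul (α : 𝕜) f,
        Lp.coeFn_smul (β : 𝕜) g] with ω h0 h1 h2 h3 h4 h5 h6
      rw [h4, Pi.add_apply, h5, h6, Pi.smul_apply, Pi.smul_apply, smul_eq_mul, smul_eq_mul,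
        ← RCLike.norm_of_nonneg' h1, ← RCLike.norm_of_nonneg' h2, ← RCLike.norm_of_nonneg' h3,
        ← RCLike.ofReal_mul, ← RCLike.ofReal_mul, ← RCLike.ofReal_add, RCLike.ofReal_le_ofReal]
      exact h0.trans (rpow_mul_rpow_le_young hθ (norm_nonneg _) (norm_nonneg _) hc')
    have hl' := hB.mono hl
    rw [map_add, map_smul, map_smul] at hl'
    filter_upwards [(Lp.coeFn_le _ _).2 hl', lp_ae_nonneg (hB.apply_nonneg hh),
      Lp.coeFn_add ((α : 𝕜) • B f) ((β : 𝕜) • B g), Lp.coeFn_smul (α : 𝕜) (B f),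
      Lp.coeFn_smul (β : 𝕜) (B g)] with ω h0 h1 h4 h5 h6
    rw [h4, Pi.add_apply, h5, h6, Pi.smul_apply, Pi.smul_apply] at h0
    refine (RCLike.norm_le_norm_of_nonneg_of_le h1 h0).trans ((norm_add_le _ _).trans ?_)
    rw [norm_smul, norm_smul, RCLike.norm_ofReal, RCLike.norm_ofReal, abs_of_nonneg hα,
      abs_of_nonneg hβ]
  have hall : ∀ᵐ ω ∂μ, ∀ c : ℚ, 0 < c → ‖B h ω‖ ≤
      (1 - θ) * (c : ℝ) ^ θ * ‖B f ω‖ + θ * (c : ℝ) ^ (-(1 - θ)) * ‖B g ω‖ :=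
    ae_all_iff.2 fun c => by
      by_cases hc : 0 < c
      · filter_upwards [key c hc] with ω hω _ using hω
      · exact Eventually.of_forall fun ω h => absurd h hc
  filter_upwards [hall] with ω hω
  exact le_rpow_mul_rpow_of_forall_young hθ (norm_nonneg _) (norm_nonneg _) hω

theorem lp_exists_subseq_ae_tendsto {f : ℕ → Lp 𝕜 p μ} {x : Lp 𝕜 p μ}
    (h : Tendsto f atTop (𝓝 x)) :
    ∃ ns : ℕ → ℕ, StrictMono ns ∧
      ∀ᵐ ω ∂μ, Tendsto (fun i => f (ns i) ω) atTop (𝓝 (x ω)) :=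
  (tendstoInMeasure_of_tendsto_Lp h).exists_seq_tendsto_ae

theorem GeomMeanLE.of_tendsto {θ : ℝ} (hθ : θ ∈ Set.Ioo (0 : ℝ) 1) {h f g : ℕ → Lp 𝕜 p μ}
    {h₀ f₀ g₀ : Lp 𝕜 p μ} (hh : Tendsto h atTop (𝓝 h₀)) (hf : Tendsto f atTop (𝓝 f₀))
    (hg : Tendsto g atTop (𝓝 g₀)) (hle : ∀ n, GeomMeanLE θ (h n) (f n) (g n)) :
    GeomMeanLE θ h₀ f₀ g₀ := by
  obtain ⟨n₁, hn₁, h1⟩ := lp_exists_subseq_ae_tendsto hh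
  obtain ⟨n₂, hn₂, h2⟩ := lp_exists_subseq_ae_tendsto (hf.comp hn₁.tendsto_atTop)
  obtain ⟨n₃, hn₃, h3⟩ := lp_exists_subseq_ae_tendsto
    (hg.comp (hn₁.tendsto_atTop.comp hn₂.tendsto_atTop))
  filter_upwards [h1, h2, h3, ae_all_iff.2 hle] with ω k1 k2 k3 k4
  have k1' := (k1.comp (hn₂.tendsto_atTop.comp hn₃.tendsto_atTop)).norm
  have k2' := ((k2.comp hn₃.tendsto_atTop).norm).rpow_const (p := 1 - θ)
    (Or.inr (sub_nonneg.2 hθ.2.le))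
  have k3' := k3.norm.rpow_const (p := θ) (Or.inr hθ.1.le)
  exact le_of_tendsto_of_tendsto' k1' (k2'.mul k3') fun i => k4 _

variable {T : ℝ≥0 → Lp 𝕜 p μ →L[𝕜] Lp 𝕜 p μ} {W : Ω → ℝ}

theorem norm_mulLp_exp_ae (hW : IsBddMeasurable W) (s : ℝ≥0) (f : Lp 𝕜 p μ) :
    ∀ᵐ ω ∂μ, ‖mulLp (fun ω => Real.exp (-(s * W ω))) f ω‖ = Real.exp (-(s * W ω)) * ‖f ω‖ := by
  filter_upwards [coeFn_mulLp (hW.exp_neg s) f] with ω hω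
  rw [hω, norm_mul, RCLike.norm_ofReal, Real.abs_exp]

theorem isBddMeasurable_zero : IsBddMeasurable fun _ : Ω => (0 : ℝ) :=
  ⟨measurable_const, 0, by simp⟩

/-- Multiplication preserves the relation because $e^{-s\theta W}=1^{1-\theta}(e^{-sW})^\theta$; `T
s` preserves it by the Hölder inequality for positive operators. -/
theorem GeomMeanLE.trotterStep_pow (hTpos : ∀ t, IsPositiveLpOperator (T t))
    (hW : IsBddMeasurable W) {θ : ℝ} (hθ : θ ∈ Set.Ioo (0 : ℝ) 1) {h f g : Lp 𝕜 p μ}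
    (hh : 0 ≤ h) (hf : 0 ≤ f) (hg : 0 ≤ g) (hle : GeomMeanLE θ h f g) (s : ℝ≥0) (k : ℕ) :
    GeomMeanLE θ ((trotterStep T (fun ω => θ * W ω) s ^ k) h)
      ((trotterStep T (fun _ => 0) s ^ k) f) ((trotterStep T W s ^ k) g) := by
  have hWθ := hW.const_mul θ
  have h0 := isBddMeasurable_zero (Ω := Ω)
  induction k with
  | zero => exact hle
  | succ k ih =>
    have e : ∀ (φ : Ω → ℝ) (u : Lp 𝕜 p μ), (trotterStep T φ s ^ (k + 1)) u =
        T s (mulLp (fun ω => Real.exp (-(s * φ ω))) ((trotterStep T φ s ^ k) u)) := fun φ u => by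
      rw [pow_succ']; rfl
    rw [e, e, e]
    have hh' := ((isPositiveLpOperator_trotterStep hTpos hWθ s).pow k).apply_nonneg hh
    have hf' := ((isPositiveLpOperator_trotterStep hTpos h0 s).pow k).apply_nonneg hf
    have hg' := ((isPositiveLpOperator_trotterStep hTpos hW s).pow k).apply_nonneg hg
    have hpos : ∀ {φ : Ω → ℝ}, IsBddMeasurable φ → IsPositiveLpOperator
        (mulLp (fun ω => Real.exp (-(s * φ ω))) : Lp 𝕜 p μ →L[𝕜] Lp 𝕜 p μ) := fun h =>
      isPositiveLpOperator_mulLp (h.exp_neg s) fun _ => (Real.exp_pos _).le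
    refine (hTpos s).geomMeanLE hθ ((hpos hWθ).apply_nonneg hh') ((hpos h0).apply_nonneg hf')
      ((hpos hW).apply_nonneg hg') ?_
    filter_upwards [ih, norm_mulLp_exp_ae hWθ s ((trotterStep T (fun ω => θ * W ω) s ^ k) h),
      norm_mulLp_exp_ae h0 s ((trotterStep T (fun _ => 0) s ^ k) f),
      norm_mulLp_exp_ae hW s ((trotterStep T W s ^ k) g)] with ω h1 h2 h3 h4
    rw [h2, h3, h4, mul_zero, neg_zero, Real.exp_zero, one_mul,
      Real.mul_rpow (Real.exp_pos _).le (norm_nonneg _), ← Real.exp_mul,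
      show -(s * W ω) * θ = -(s * (θ * W ω)) by ring,
      mul_left_comm (_ ^ (1 - θ)) (Real.exp (-(s * (θ * W ω))))]
    exact mul_le_mul_of_nonneg_left h1 (Real.exp_pos _).le

theorem GeomMeanLE.boundedPerturbation (hT : IsC0Semigroup T)
    (hTpos : ∀ t, IsPositiveLpOperator (T t))
    (hW : IsBddMeasurable W) {θ : ℝ} (hθ : θ ∈ Set.Ioo (0 : ℝ) 1) {h f g : Lp 𝕜 p μ}
    (hh : 0 ≤ h) (hf : 0 ≤ f) (hg : 0 ≤ g) (hle : GeomMeanLE θ h f g) (t : ℝ≥0) :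
    GeomMeanLE θ (boundedPerturbation T (fun ω => θ * W ω) t h) (T t f)
      (boundedPerturbation T W t g) := by
  have h0 := tendsto_trotterStep_pow hT isBddMeasurable_zero t f
  rw [boundedPerturbation_zero hT] at h0
  exact GeomMeanLE.of_tendsto hθ (tendsto_trotterStep_pow hT (hW.const_mul θ) t h) h0
    (tendsto_trotterStep_pow hT hW t g)
    fun _ => hle.trotterStep_pow hTpos hW hθ hh hf hg _ _

end GeometricMean

/-! ### Strong limits of squeezed semigroups. -/

section StrongLimits

open scoped ComplexOrder

variable {Ω 𝕜 : Type*} [MeasurableSpace Ω] [RCLike 𝕜] {μ : Measure Ω} {p : ℝ≥0∞} [Fact (1 ≤ p)]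

theorem exists_strong_limit_of_nonneg {ι : Type*} {l : Filter ι} [l.NeBot]
    [l.IsCountablyGenerated] {S : ι → Lp 𝕜 p μ →L[𝕜] Lp 𝕜 p μ}
    (h : ∀ f, 0 ≤ f → ∃ y, Tendsto (fun i => S i f) l (𝓝 y)) :
    ∃ R : Lp 𝕜 p μ →L[𝕜] Lp 𝕜 p μ, ∀ f, Tendsto (fun i => S i f) l (𝓝 (R f)) := by
  have hall : ∀ f, ∃ y, Tendsto (fun i => S i f) l (𝓝 y) := fun f => by
    induction f using lp_induction_nonneg with
    | hnn f hf => exact h f hf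
    | hadd f g hf hg =>
      obtain ⟨y, hy⟩ := hf
      obtain ⟨z, hz⟩ := hg
      exact ⟨y + z, by simpa using hy.add hz⟩
    | hsmul c f hf =>
      obtain ⟨y, hy⟩ := hf
      exact ⟨c • y, by simpa using hy.const_smul c⟩
  choose R hR using hall
  exact ⟨continuousLinearMapOfTendsto S (tendsto_pi_nhds.2 hR), hR⟩

theorem tendsto_apply_of_strong_limit {E : Type*} [NormedAddCommGroup E] [NormedSpace 𝕜 E]
    [CompleteSpace E] {S : ℕ → E →L[𝕜] E} {R : E →L[𝕜] E}
    (h : ∀ x, Tendsto (fun n => S n x) atTop (𝓝 (R x))) {y : ℕ → E} {x : E}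
    (hy : Tendsto y atTop (𝓝 x)) : Tendsto (fun n => S n (y n)) atTop (𝓝 (R x)) := by
  obtain ⟨C, hC⟩ : ∃ C, ∀ n, ‖S n‖ ≤ C := banach_steinhaus fun x => by
    obtain ⟨C, hC⟩ := (h x).norm.bddAbove_range
    exact ⟨C, fun n => hC ⟨n, rfl⟩⟩
  have h1 : Tendsto (fun n => S n (y n - x)) atTop (𝓝 0) := by
    refine squeeze_zero_norm (fun n => (S n).le_of_opNorm_le (hC n) _) ?_
    simpa using ((hy.sub_const x).norm.const_mul C)
  simpa using h1.add (h x)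

/-- A strong limit of semigroups that are squeezed between two `C₀`-semigroups is a
`C₀`-semigroup. -/
theorem exists_isC0Semigroup_limit {S : ℕ → ℝ≥0 → Lp 𝕜 p μ →L[𝕜] Lp 𝕜 p μ}
    {L U : ℝ≥0 → Lp 𝕜 p μ →L[𝕜] Lp 𝕜 p μ} (hS : ∀ n, IsC0Semigroup (S n))
    (hL : IsC0Semigroup L) (hU : IsC0Semigroup U)
    (hL0 : ∀ t, IsPositiveLpOperator (L t)) (hLS : ∀ n t, LpOperatorLE (L t) (S n t))
    (hSU : ∀ n t, LpOperatorLE (S n t) (U t))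
    (hlim : ∀ t f, 0 ≤ f → ∃ y, Tendsto (fun n => S n t f) atTop (𝓝 y)) :
    ∃ R : ℝ≥0 → Lp 𝕜 p μ →L[𝕜] Lp 𝕜 p μ, IsC0Semigroup R ∧ StronglyTendsto S R := by
  choose R hR using fun t => exists_strong_limit_of_nonneg (hlim t)
  have hLR : ∀ t, LpOperatorLE (L t) (R t) := fun t f hf =>
    ge_of_tendsto' (hR t f) fun n => hLS n t f hf
  have hRU : ∀ t, LpOperatorLE (R t) (U t) := fun t f hf =>
    le_of_tendsto' (hR t f) fun n => hSU n t f hf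
  refine ⟨R, isC0Semigroup_of_tendsto_zero ?_ (fun s t => ?_) (fun a => ?_) fun f => ?_, hR⟩
  · ext1 f
    refine tendsto_nhds_unique (hR 0 f) ?_
    simp only [(hS _).map_zero]
    exact tendsto_const_nhds
  · ext1 f
    refine tendsto_nhds_unique (hR (s + t) f) ?_
    simp only [(hS _).map_add]
    exact tendsto_apply_of_strong_limit (hR s) (hR t f)
  · have hb : ∀ f, ∃ C, ∀ t : Set.Iic a, ‖R t f‖ ≤ C := fun f => by
      induction f using lp_induction_nonneg with
      | hnn f hf =>
        obtain ⟨C, hC⟩ := isCompact_Icc.exists_bound_of_continuousOn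
          (hU.strong_continuous f).continuousOn (s := Set.Icc (0 : ℝ≥0) a)
        exact ⟨C, fun t => (lp_norm_le_norm_of_nonneg_of_le
          (((hL0 t).apply_nonneg hf).trans (hLR t f hf)) (hRU t f hf)).trans
          (hC t ⟨zero_le, t.2⟩)⟩
      | hadd f g hf hg =>
        obtain ⟨C, hC⟩ := hf
        obtain ⟨C', hC'⟩ := hg
        refine ⟨C + C', fun t => ?_⟩
        rw [map_add]
        exact (norm_add_le _ _).trans (add_le_add (hC t) (hC' t))
      | hsmul c f hf =>
        obtain ⟨C, hC⟩ := hf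
        refine ⟨‖c‖ * C, fun t => ?_⟩
        rw [map_smul, norm_smul]
        exact mul_le_mul_of_nonneg_left (hC t) (norm_nonneg _)
    obtain ⟨C, hC⟩ := banach_steinhaus hb
    exact ⟨C, fun t ht => hC ⟨t, ht⟩⟩
  · induction f using lp_induction_nonneg with
    | hnn f hf =>
      have h1 := (hL.strong_continuous f).tendsto 0
      have h2 := (hU.strong_continuous f).tendsto 0
      simp only [hL.map_zero_apply] at h1
      simp only [hU.map_zero_apply] at h2
      exact lp_tendsto_of_le_of_le h1 h2 (Eventually.of_forall fun t => hLR t f hf)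
        (Eventually.of_forall fun t => hRU t f hf)
    | hadd f g hf hg => simpa using hf.add hg
    | hsmul c f hf => simpa using hf.const_smul c

end StrongLimits

/-! ### Admissibility of smaller potentials and convergence of truncations. -/

section Admissible

open scoped ComplexOrder

variable {Ω 𝕜 : Type*} [MeasurableSpace Ω] [RCLike 𝕜] {μ : Measure Ω} {p : ℝ≥0∞} [Fact (1 ≤ p)]
  {T : ℝ≥0 → Lp 𝕜 p μ →L[𝕜] Lp 𝕜 p μ}

theorem isBddMeasurable_min {P : Ω → ℝ} (hP : Measurable P) (hP0 : ∀ ω, 0 ≤ P ω) {a : ℝ}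
    (ha : 0 ≤ a) : IsBddMeasurable fun ω => min (P ω) a :=
  ⟨hP.min measurable_const, a, fun ω => by
    rw [abs_of_nonneg (le_min (hP0 ω) ha)]; exact min_le_right _ _⟩

theorem isBddMeasurable_neg_min {P : Ω → ℝ} (hP : Measurable P) (hP0 : ∀ ω, 0 ≤ P ω) {a : ℝ}
    (ha : 0 ≤ a) : IsBddMeasurable fun ω => -min (P ω) a := by
  simpa using (isBddMeasurable_min hP hP0 ha).const_mul (-1)

/-- On the positive cone $T_{Q\wedge n}$ decreases in $n$ and stays between the limit semigroup for
`P` and $T$. Monotone convergence gives the limit, the squeeze its strong continuity. -/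
theorem IsAdmissibleNonneg.mono (hp : p ≠ ∞) (hT : IsC0Semigroup T)
    (hTpos : ∀ t, IsPositiveLpOperator (T t)) {P Q : Ω → ℝ} (hP : Measurable P)
    (hQ : Measurable Q) (hQ0 : ∀ ω, 0 ≤ Q ω) (hQP : ∀ ω, Q ω ≤ P ω)
    (h : IsAdmissibleNonneg T P) : IsAdmissibleNonneg T Q := by
  obtain ⟨L, hL, hlim⟩ := h
  have hP0 : ∀ ω, 0 ≤ P ω := fun ω => (hQ0 ω).trans (hQP ω)
  have bP := fun n : ℕ => isBddMeasurable_min hP hP0 n.cast_nonneg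
  have bQ := fun n : ℕ => isBddMeasurable_min hQ hQ0 n.cast_nonneg
  have hpos := fun n : ℕ => isPositiveLpOperator_boundedPerturbation hT hTpos (bQ n)
  have hanti : ∀ t f, 0 ≤ f → Antitone fun n : ℕ =>
      boundedPerturbation T (fun ω => min (Q ω) (n : ℝ)) t f := fun t f hf m n hmn =>
    boundedPerturbation_le hT hTpos (bQ m) (bQ n)
      (fun ω => min_le_min_left _ (by exact_mod_cast hmn)) t f hf
  refine exists_isC0Semigroup_limit (fun n => isC0Semigroup_boundedPerturbation hT (bQ n)) hL hT
    (fun t => isPositiveLpOperator_iff.2 fun f hf => ge_of_tendsto' (hlim t f) fun n =>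
      (isPositiveLpOperator_boundedPerturbation hT hTpos (bP n) t).apply_nonneg hf)
    (fun n t f hf => ?_) (fun n t => ?_) fun t f hf =>
      lp_exists_tendsto_of_antitone hp (hanti t f hf) fun n => (hpos n t).apply_nonneg hf
  · refine le_of_tendsto (hlim t f) ?_
    filter_upwards [eventually_ge_atTop n] with m hm
    exact boundedPerturbation_le hT hTpos (bQ n) (bP m)
      (fun ω => min_le_min (hQP ω) (by exact_mod_cast hm)) t f hf
  · have := boundedPerturbation_le hT hTpos isBddMeasurable_zero (bQ n)
      (fun ω => le_min (hQ0 ω) n.cast_nonneg) t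
    rwa [boundedPerturbation_zero hT] at this

/-- Here the sequence increases, and the limit semigroup for $-P$ is the upper bound that makes it
converge. -/
theorem IsAdmissibleNonpos.mono (hp : p ≠ ∞) (hT : IsC0Semigroup T)
    (hTpos : ∀ t, IsPositiveLpOperator (T t)) {P Q : Ω → ℝ} (hP : Measurable P)
    (hQ : Measurable Q) (hQ0 : ∀ ω, 0 ≤ Q ω) (hQP : ∀ ω, Q ω ≤ P ω)
    (h : IsAdmissibleNonpos T fun ω => -P ω) : IsAdmissibleNonpos T fun ω => -Q ω := by
  obtain ⟨U, hU, hlim⟩ := h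
  have hP0 : ∀ ω, 0 ≤ P ω := fun ω => (hQ0 ω).trans (hQP ω)
  have bP := fun n : ℕ => isBddMeasurable_neg_min hP hP0 n.cast_nonneg
  have bQ := fun n : ℕ => isBddMeasurable_neg_min hQ hQ0 n.cast_nonneg
  unfold IsAdmissibleNonpos
  simp only [max_neg_neg] at hlim ⊢
  have hmono : ∀ t f, 0 ≤ f → Monotone fun n : ℕ =>
      boundedPerturbation T (fun ω => -min (Q ω) (n : ℝ)) t f := fun t f hf m n hmn =>
    boundedPerturbation_le hT hTpos (bQ n) (bQ m)
      (fun ω => neg_le_neg (min_le_min_left _ (by exact_mod_cast hmn))) t f hf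
  have hle : ∀ (n : ℕ) t, LpOperatorLE (boundedPerturbation T (fun ω => -min (Q ω) (n : ℝ)) t)
      (U t) := fun n t f hf => by
    refine ge_of_tendsto (hlim t f) ?_
    filter_upwards [eventually_ge_atTop n] with m hm
    exact boundedPerturbation_le hT hTpos (bP m) (bQ n)
      (fun ω => neg_le_neg (min_le_min (hQP ω) (by exact_mod_cast hm))) t f hf
  refine exists_isC0Semigroup_limit (fun n => isC0Semigroup_boundedPerturbation hT (bQ n)) hT hU
    hTpos (fun n t => ?_) hle fun t f hf =>
      lp_exists_tendsto_of_monotone hp (hmono t f hf) fun n => hle n t f hf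
  have := boundedPerturbation_le hT hTpos (bQ n) isBddMeasurable_zero
    (fun ω => neg_nonpos.2 (le_min (hQ0 ω) n.cast_nonneg)) t
  rwa [boundedPerturbation_zero hT] at this

theorem IsAdmissible.const_mul (hp : p ≠ ∞) (hT : IsC0Semigroup T)
    (hTpos : ∀ t, IsPositiveLpOperator (T t)) {V : Ω → ℝ} (hV : IsAdmissible T V) {θ : ℝ}
    (hθ0 : 0 ≤ θ) (hθ1 : θ ≤ 1) : IsAdmissible T fun ω => θ * V ω := by
  obtain ⟨hm, hpos, hneg⟩ := hV
  have key : ∀ v : ℝ, max (θ * v) 0 ≤ max v 0 := fun v => by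
    refine max_le ?_ (le_max_right _ _)
    rcases le_total 0 v with h | h
    · exact (mul_le_of_le_one_left h hθ1).trans (le_max_left _ _)
    · exact (mul_nonpos_of_nonneg_of_nonpos hθ0 h).trans (le_max_right _ _)
  refine ⟨hm.const_mul θ, ?_, ?_⟩
  · exact hpos.mono hp hT hTpos (hm.max measurable_const) ((hm.const_mul θ).max measurable_const)
      (fun _ => le_max_right _ _) fun ω => key _
  · exact hneg.mono hp hT hTpos (hm.neg.max measurable_const)
      ((hm.const_mul θ).neg.max measurable_const)
      (fun _ => le_max_right _ _) fun ω => by rw [← mul_neg]; exact key _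

theorem max_min_neg_eq_sub (v a : ℝ) (ha : 0 ≤ a) :
    max (min v a) (-a) = min (max v 0) a + -min (max (-v) 0) a := by
  rcases le_total 0 v with h | h
  · rw [max_eq_left h, max_eq_right (by linarith : -v ≤ 0), min_eq_left ha, neg_zero, add_zero]
    exact max_eq_left ((neg_nonpos.2 ha).trans (le_min h ha))
  · rw [max_eq_right h, max_eq_left (by linarith : 0 ≤ -v), min_eq_left ha,
      min_eq_left (h.trans ha), zero_add, ← max_neg_neg, neg_neg]

/-- For an admissible potential the semigroups of its truncations converge strongly. -/
theorem IsAdmissible.exists_strong_limit (hp : p ≠ ∞) (hT : IsC0Semigroup T)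
    (hTpos : ∀ t, IsPositiveLpOperator (T t)) {V : Ω → ℝ} (hV : IsAdmissible T V) :
    ∃ R : ℝ≥0 → Lp 𝕜 p μ →L[𝕜] Lp 𝕜 p μ, ∀ t f, Tendsto
      (fun a : ℝ => boundedPerturbation T (fun ω => max (min (V ω) a) (-a)) t f) atTop
      (𝓝 (R t f)) := by
  obtain ⟨hm, -, S, -, hS⟩ := hV
  simp only [max_neg_neg] at hS
  set P : Ω → ℝ := fun ω => max (V ω) 0
  set N : Ω → ℝ := fun ω => max (-V ω) 0
  have hP : Measurable P := hm.max measurable_const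
  have hN : Measurable N := hm.neg.max measurable_const
  have hP0 : ∀ ω, 0 ≤ P ω := fun _ => le_max_right _ _
  have hN0 : ∀ ω, 0 ≤ N ω := fun _ => le_max_right _ _
  have bP := fun (a : ℝ) (ha : 0 ≤ a) => isBddMeasurable_min hP hP0 ha
  have bN := fun (a : ℝ) (ha : 0 ≤ a) => isBddMeasurable_neg_min hN hN0 ha
  have bD := fun (a b : ℝ) (ha : 0 ≤ a) (hb : 0 ≤ b) => (bP a ha).add (bN b hb)
  have main : ∀ t f, 0 ≤ f → ∃ y, Tendsto
      (fun a : ℝ => boundedPerturbation T (fun ω => max (min (V ω) a) (-a)) t f) atTop (𝓝 y) := by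
    intro t f hf
    -- Separate cut-offs `a` for $V^+$ and `b` for $V^-$; the diagonal is the truncation of $V$, and
    -- `D₀` is the case without $V^+$.
    set D : ℝ → ℝ → Lp 𝕜 p μ := fun a b =>
      boundedPerturbation T (fun ω => min (P ω) a + -min (N ω) b) t f with hD
    set D₀ : ℝ → Lp 𝕜 p μ := fun b => boundedPerturbation T (fun ω => -min (N ω) b) t f
    have hDD : ∀ a b b', 0 ≤ a → 0 ≤ b → b ≤ b' → D a b' - D a b ≤ D₀ b' - D₀ b :=
      fun a b b' ha hb hbb => boundedPerturbation_sub_le hT hTpos (bP a ha)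
        (fun ω => le_min (hP0 ω) ha) (bN b' (hb.trans hbb)) (bN b hb)
        (fun ω => neg_le_neg (min_le_min_left _ hbb)) t hf
    have hDmono : ∀ a b b', 0 ≤ a → 0 ≤ b → b ≤ b' → D a b ≤ D a b' :=
      fun a b b' ha hb hbb => boundedPerturbation_le hT hTpos (bD a b' ha (hb.trans hbb))
        (bD a b ha hb) (fun ω => add_le_add_right (neg_le_neg (min_le_min_left _ hbb)) _) t f hf
    have hDanti : ∀ b, 0 ≤ b → AntitoneOn (fun a => D a b) (Set.Ici 0) :=
      fun b hb a ha a' ha' haa => boundedPerturbation_le hT hTpos (bD a b ha hb) (bD a' b ha' hb)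
        (fun ω => add_le_add_left (min_le_min_left _ haa) _) t f hf
    have hD₀mono : MonotoneOn D₀ (Set.Ici 0) := fun b hb b' hb' hbb =>
      boundedPerturbation_le hT hTpos (bN b' hb') (bN b hb)
        (fun ω => neg_le_neg (min_le_min_left _ hbb)) t f hf
    have hD₀lim : Tendsto D₀ atTop (𝓝 (S t f)) := lp_tendsto_atTop_real_of_monotone hD₀mono (hS t f)
    have hDlim : ∀ b, 0 ≤ b → ∃ y, Tendsto (fun a => D a b) atTop (𝓝 y) := fun b hb => by
      obtain ⟨y, hy⟩ := lp_exists_tendsto_of_antitone hp (f := fun n : ℕ => D n b)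
        (fun m n hmn => hDanti b hb (Set.mem_Ici.2 m.cast_nonneg) (Set.mem_Ici.2 n.cast_nonneg)
          (by exact_mod_cast hmn))
        fun n => (isPositiveLpOperator_boundedPerturbation hT hTpos
          (bD n b n.cast_nonneg hb) t).apply_nonneg hf
      exact ⟨y, lp_tendsto_atTop_real_of_antitone (hDanti b hb) hy⟩
    -- Interchange of limits: by `hDD`, `D a b` is close to `D a a` uniformly in `a ≥ b` once `b` is
    -- large, and for that fixed `b` the values `D a b` converge.
    have hcauchy : Cauchy (map (fun a => D a a) atTop) := by
      refine Metric.cauchy_iff.2 ⟨inferInstance, fun ε hε => ?_⟩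
      obtain ⟨s, hs, hsε⟩ := (Metric.cauchy_iff.1 hD₀lim.cauchy_map).2 (ε / 3) (by positivity)
      obtain ⟨b₀, hb₀⟩ := mem_atTop_sets.1 (mem_map.1 hs)
      obtain ⟨b, hb, hb0⟩ : ∃ b, (∀ b' ≥ b, D₀ b' ∈ s) ∧ 0 ≤ b :=
        ⟨max b₀ 0, fun b' hb' => hb₀ b' ((le_max_left _ _).trans hb'), le_max_right _ _⟩
      obtain ⟨y, hy⟩ := hDlim b hb0
      obtain ⟨u, hu, huε⟩ := (Metric.cauchy_iff.1 hy.cauchy_map).2 (ε / 3) (by positivity)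
      have hclose : ∀ a, b ≤ a → dist (D a a) (D a b) < ε / 3 := fun a ha => by
        rw [dist_eq_norm]
        refine (lp_norm_le_norm_of_nonneg_of_le
          (sub_nonneg.2 (hDmono a b a (hb0.trans ha) hb0 ha))
          (hDD a b a (hb0.trans ha) hb0 ha)).trans_lt ?_
        rw [← dist_eq_norm]
        exact hsε _ (hb a ha) _ (hb b le_rfl)
      refine ⟨_, image_mem_map (inter_mem (mem_map.1 hu) (Ici_mem_atTop b)), ?_⟩
      rintro _ ⟨a, ⟨ha, hab⟩, rfl⟩ _ ⟨a', ⟨ha', hab'⟩, rfl⟩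
      have h1 := hclose a hab
      have h2 := hclose a' hab'
      have h3 := huε _ ha _ ha'
      have h4 := dist_triangle4 (D a a) (D a b) (D a' b) (D a' a')
      rw [dist_comm] at h2
      linarith
    obtain ⟨y, hy⟩ := CompleteSpace.complete hcauchy
    refine ⟨y, Tendsto.congr' ?_ (show Tendsto (fun a => D a a) atTop (𝓝 y) from hy)⟩
    filter_upwards [eventually_ge_atTop 0] with a ha
    simp only [hD, max_min_neg_eq_sub _ a ha, P, N]
  choose R hR using fun t => exists_strong_limit_of_nonneg (main t)
  exact ⟨R, hR⟩

/-- Real levels are needed because truncating $\theta V$ at $n$ is $\theta$ times truncating $V$ at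
$n/\theta$. -/
theorem IsAdmissible.tendsto_real (hp : p ≠ ∞) (hT : IsC0Semigroup T)
    (hTpos : ∀ t, IsPositiveLpOperator (T t)) {V : Ω → ℝ} (hV : IsAdmissible T V) (t : ℝ≥0)
    (f : Lp 𝕜 p μ) : Tendsto
      (fun a : ℝ => boundedPerturbation T (fun ω => max (min (V ω) a) (-a)) t f) atTop
      (𝓝 (perturbedSemigroup T V t f)) := by
  obtain ⟨R, hR⟩ := hV.exists_strong_limit hp hT hTpos
  have hst : StronglyTendsto (truncatedPerturbation T V) R := fun t f =>
    (hR t f).comp tendsto_natCast_atTop_atTop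
  have h : ∃ R, StronglyTendsto (truncatedPerturbation T V) R := ⟨R, hst⟩
  rw [perturbedSemigroup, dif_pos h, tendsto_nhds_unique (h.choose_spec t f) (hst t f)]
  exact hR t f

theorem IsAdmissible.stronglyTendsto (hp : p ≠ ∞) (hT : IsC0Semigroup T)
    (hTpos : ∀ t, IsPositiveLpOperator (T t)) {V : Ω → ℝ} (hV : IsAdmissible T V) :
    StronglyTendsto (truncatedPerturbation T V) (perturbedSemigroup T V) := fun t f =>
  (hV.tendsto_real hp hT hTpos t f).comp tendsto_natCast_atTop_atTop

theorem isBddMeasurable_truncation {V : Ω → ℝ} (hV : Measurable V) {a : ℝ} (ha : 0 ≤ a) :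
    IsBddMeasurable fun ω => max (min (V ω) a) (-a) :=
  ⟨(hV.min measurable_const).max measurable_const, a, fun ω =>
    abs_le.2 ⟨le_max_right _ _, max_le (min_le_right _ _) (by linarith)⟩⟩

theorem IsAdmissible.isPositiveLpOperator (hp : p ≠ ∞) (hT : IsC0Semigroup T)
    (hTpos : ∀ t, IsPositiveLpOperator (T t)) {V : Ω → ℝ} (hV : IsAdmissible T V) (t : ℝ≥0) :
    IsPositiveLpOperator (perturbedSemigroup T V t) :=
  isPositiveLpOperator_iff.2 fun f hf => ge_of_tendsto' (hV.stronglyTendsto hp hT hTpos t f)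
    fun n => (isPositiveLpOperator_boundedPerturbation hT hTpos
      (isBddMeasurable_truncation hV.1 n.cast_nonneg) t).apply_nonneg hf

theorem GeomMeanLE.perturbedSemigroup (hp : p ≠ ∞) (hT : IsC0Semigroup T)
    (hTpos : ∀ t, IsPositiveLpOperator (T t)) {V : Ω → ℝ} (hV : IsAdmissible T V) {θ : ℝ}
    (hθ : θ ∈ Set.Ioo (0 : ℝ) 1) {h f g : Lp 𝕜 p μ}
    (hh : 0 ≤ h) (hf : 0 ≤ f) (hg : 0 ≤ g) (hle : GeomMeanLE θ h f g) (t : ℝ≥0) :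
    GeomMeanLE θ (perturbedSemigroup T (fun ω => θ * V ω) t h) (T t f)
      (perturbedSemigroup T V t g) := by
  have hdiv : Tendsto (fun n : ℕ => (n : ℝ) / θ) atTop atTop :=
    tendsto_natCast_atTop_atTop.atTop_div_const hθ.1
  have h1 := (hV.const_mul hp hT hTpos hθ.1.le hθ.2.le).stronglyTendsto hp hT hTpos t h
  have h2 := (hV.tendsto_real hp hT hTpos t g).comp hdiv
  refine GeomMeanLE.of_tendsto hθ h1 tendsto_const_nhds h2 fun n => ?_
  have hW := isBddMeasurable_truncation hV.1 (a := n / θ) (div_nonneg n.cast_nonneg hθ.1.le)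
  have := hle.boundedPerturbation hT hTpos hW hθ hh hf hg t
  have e : (fun ω => θ * max (min (V ω) (n / θ)) (-(n / θ))) =
      fun ω => max (min (θ * V ω) n) (-(n : ℝ)) := by
    funext ω
    rw [mul_max_of_nonneg _ _ hθ.1.le, mul_min_of_nonneg _ _ hθ.1.le, mul_neg,
      mul_div_cancel₀ _ hθ.1.ne']
  rwa [e] at this

end Admissible

/-! ### Domination $|Bg|\le Bh$ for positive operators, including complex scalars. -/

section Modulus

open scoped ComplexOrder

variable {Ω 𝕜 : Type*} [MeasurableSpace Ω] [RCLike 𝕜] {μ : Measure Ω} {p : ℝ≥0∞} [Fact (1 ≤ p)]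

theorem lpOfReal_le {φ : Ω → ℝ} (hφ : MemLp φ p μ) {h : Lp 𝕜 p μ} (hh : 0 ≤ h)
    (hle : ∀ᵐ ω ∂μ, φ ω ≤ ‖h ω‖) : lpOfReal φ hφ ≤ h := by
  rw [← Lp.coeFn_le]
  filter_upwards [coeFn_lpOfReal (𝕜 := 𝕜) hφ, lp_ae_nonneg hh, hle] with ω h1 h2 h3
  rw [h1, ← RCLike.norm_of_nonneg' h2, RCLike.ofReal_le_ofReal]
  exact h3

theorem IsPositiveLpOperator.re_apply_le {B : Lp 𝕜 p μ →L[𝕜] Lp 𝕜 p μ}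
    (hB : IsPositiveLpOperator B) {g h : Lp 𝕜 p μ} (hh : 0 ≤ h)
    (hle : ∀ᵐ ω ∂μ, ‖g ω‖ ≤ ‖h ω‖) : ∀ᵐ ω ∂μ, RCLike.re (B g ω) ≤ ‖B h ω‖ := by
  have hg := Lp.memLp g
  set u : Lp 𝕜 p μ := lpOfReal (fun ω => RCLike.re (g ω)) hg.re
  set v : Lp 𝕜 p μ := lpOfReal (fun ω => RCLike.im (g ω)) hg.im
  have e : g = u + (RCLike.I : 𝕜) • v := by
    refine Lp.ext ?_
    filter_upwards [coeFn_lpOfReal (𝕜 := 𝕜) hg.re, coeFn_lpOfReal (𝕜 := 𝕜) hg.im,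
      Lp.coeFn_add u ((RCLike.I : 𝕜) • v), Lp.coeFn_smul (RCLike.I : 𝕜) v] with ω h1 h2 h3 h4
    rw [h3, Pi.add_apply, h4, Pi.smul_apply, h1, h2, smul_eq_mul, mul_comm, RCLike.re_add_im]
  have hu : B u ≤ B h := hB.mono (lpOfReal_le _ hh (by
    filter_upwards [hle] with ω hω using (RCLike.re_le_norm _).trans hω))
  have hv : B v ≤ B h := hB.mono (lpOfReal_le _ hh (by
    filter_upwards [hle] with ω hω using (RCLike.im_le_norm _).trans hω))
  have eB : B g = B u + (RCLike.I : 𝕜) • B v := by rw [← map_smul, ← map_add, ← e]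
  rw [eB]
  filter_upwards [(Lp.coeFn_le _ _).2 hu, (Lp.coeFn_le _ _).2 hv, lp_ae_nonneg (hB.apply_nonneg hh),
    Lp.coeFn_add (B u) ((RCLike.I : 𝕜) • B v), Lp.coeFn_smul (RCLike.I : 𝕜) (B v)]
    with ω h1 h2 h3 h4 h5
  rw [h4, Pi.add_apply, h5, Pi.smul_apply, smul_eq_mul, map_add, RCLike.mul_re, RCLike.I_re,
    zero_mul, zero_sub]
  -- Comparability in the order of `𝕜` forces equal imaginary parts, so `B v` is real like `B h`,
  -- and $i\,Bv$ does not affect the real part.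
  have i2 : RCLike.im (B v ω) = 0 := by
    rw [(RCLike.le_iff_re_im.1 h2).2]
    exact (RCLike.nonneg_iff.1 h3).2
  rw [i2, mul_zero, neg_zero, add_zero]
  exact (RCLike.le_iff_re_im.1 h1).1.trans (RCLike.re_le_norm _)

/-- A positive operator satisfies `|B g| ≤ B h` whenever `|g| ≤ h`. -/
theorem IsPositiveLpOperator.norm_apply_le {B : Lp 𝕜 p μ →L[𝕜] Lp 𝕜 p μ}
    (hB : IsPositiveLpOperator B) {g h : Lp 𝕜 p μ} (hh : 0 ≤ h)
    (hle : ∀ᵐ ω ∂μ, ‖g ω‖ ≤ ‖h ω‖) : ∀ᵐ ω ∂μ, ‖B g ω‖ ≤ ‖B h ω‖ := by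
  have key : ∀ c : 𝕜, ∀ᵐ ω ∂μ, RCLike.re (c * B g ω) ≤ ‖c‖ * ‖B h ω‖ := by
    intro c
    have hh' : 0 ≤ ((‖c‖ : ℝ) : 𝕜) • h := by
      rw [← Lp.coeFn_nonneg]
      filter_upwards [Lp.coeFn_smul ((‖c‖ : ℝ) : 𝕜) h, lp_ae_nonneg hh] with ω h1 h2
      rw [h1, Pi.smul_apply, smul_eq_mul]
      exact mul_nonneg (RCLike.ofReal_nonneg.2 (norm_nonneg _)) h2
    have := hB.re_apply_le (g := c • g) hh' (by
      filter_upwards [Lp.coeFn_smul ((‖c‖ : ℝ) : 𝕜) h, Lp.coeFn_smul c g, hle] with ω h1 h2 h3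
      rw [h1, h2, Pi.smul_apply, Pi.smul_apply, norm_smul, norm_smul, RCLike.norm_ofReal,
        abs_norm]
      exact mul_le_mul_of_nonneg_left h3 (norm_nonneg _))
    rw [map_smul, map_smul] at this
    filter_upwards [this, Lp.coeFn_smul ((‖c‖ : ℝ) : 𝕜) (B h), Lp.coeFn_smul c (B g)]
      with ω h0 h1 h2
    rwa [h1, h2, Pi.smul_apply, Pi.smul_apply, norm_smul, RCLike.norm_ofReal, abs_norm,
      smul_eq_mul] at h0
  -- A countable dense set of multipliers keeps a single null set. Continuity then allows the
  -- multiplier $\overline{Bg(\omega)}$, which depends on `ω` and turns the real part into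
  -- $|Bg(\omega)|^2$.
  filter_upwards [ae_all_iff.2 fun n => key (TopologicalSpace.denseSeq 𝕜 n)] with ω hω
  have hall : ∀ c : 𝕜, RCLike.re (c * B g ω) ≤ ‖c‖ * ‖B h ω‖ := by
    intro c
    have hcl : IsClosed {c : 𝕜 | RCLike.re (c * B g ω) ≤ ‖c‖ * ‖B h ω‖} :=
      isClosed_le (RCLike.continuous_re.comp (continuous_id.mul continuous_const)) (by fun_prop)
    have hsub : Set.range (TopologicalSpace.denseSeq 𝕜) ⊆
        {c : 𝕜 | RCLike.re (c * B g ω) ≤ ‖c‖ * ‖B h ω‖} := by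
      rintro _ ⟨n, rfl⟩; exact hω n
    exact hcl.closure_subset_iff.2 hsub (TopologicalSpace.denseRange_denseSeq 𝕜 c)
  have h1 := hall (starRingEnd 𝕜 (B g ω))
  rw [RCLike.conj_mul, ← RCLike.ofReal_pow, RCLike.ofReal_re, RCLike.norm_conj, sq] at h1
  rcases (norm_nonneg (B g ω)).eq_or_lt with h0 | h0
  · rw [← h0]; exact norm_nonneg _
  · exact le_of_mul_le_mul_left h1 h0

end Modulus

/-! ### Interpolation of the operator norms. -/

section Interpolation

open scoped ComplexOrder

variable {Ω 𝕜 : Type*} [MeasurableSpace Ω] [RCLike 𝕜] {μ : Measure Ω} {p : ℝ≥0∞} [Fact (1 ≤ p)]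

/-- Hölder's inequality with exponents $q_0/(1-\theta)$ and $q_1/\theta$, whose reciprocals add up
to that of `interpExponent`. -/
theorem eLpNorm_le_of_geomMeanLE {θ : ℝ} (hθ : θ ∈ Set.Ioo (0 : ℝ) 1) {h f g : Lp 𝕜 p μ}
    (hle : GeomMeanLE θ h f g) (q₀ q₁ : ℝ≥0∞) :
    eLpNorm h (interpExponent θ q₀ q₁) μ ≤
      eLpNorm f q₀ μ ^ (1 - θ) * eLpNorm g q₁ μ ^ θ := by
  have h0 : ENNReal.ofReal (1 - θ) ≠ 0 := by simpa using hθ.2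
  have h1 : ENNReal.ofReal θ ≠ 0 := by simpa using hθ.1
  have hT : ENNReal.HolderTriple (q₀ / ENNReal.ofReal (1 - θ)) (q₁ / ENNReal.ofReal θ)
      (interpExponent θ q₀ q₁) := ⟨by
    rw [interpExponent, inv_inv, ENNReal.inv_div (Or.inl ENNReal.ofReal_ne_top) (Or.inl h0),
      ENNReal.inv_div (Or.inl ENNReal.ofReal_ne_top) (Or.inl h1)]⟩
  have hf := (Lp.aestronglyMeasurable f).norm.aemeasurable.pow_const (1 - θ)
  have hg := (Lp.aestronglyMeasurable g).norm.aemeasurable.pow_const θ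
  calc eLpNorm h (interpExponent θ q₀ q₁) μ
      ≤ eLpNorm ((fun ω => ‖f ω‖ ^ (1 - θ)) • fun ω => ‖g ω‖ ^ θ) (interpExponent θ q₀ q₁) μ := by
        refine eLpNorm_mono_ae_real ?_
        filter_upwards [hle] with ω hω using hω
    _ ≤ eLpNorm (fun ω => ‖f ω‖ ^ (1 - θ)) (q₀ / ENNReal.ofReal (1 - θ)) μ *
        eLpNorm (fun ω => ‖g ω‖ ^ θ) (q₁ / ENNReal.ofReal θ) μ :=
        eLpNorm_smul_le_mul_eLpNorm hg.aestronglyMeasurable hf.aestronglyMeasurable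
    _ = _ := by
        rw [eLpNorm_norm_rpow _ (sub_pos.2 hθ.2), eLpNorm_norm_rpow _ hθ.1,
          ENNReal.div_mul_cancel h0 ENNReal.ofReal_ne_top,
          ENNReal.div_mul_cancel h1 ENNReal.ofReal_ne_top]

/-- `a = r / q`, with the appropriate conventions for infinite exponents. -/
def IsExponentRatio (a : ℝ) (q r : ℝ≥0∞) : Prop :=
  (0 < a ∧ q * ENNReal.ofReal a = r) ∨ (a = 0 ∧ q = ∞)

theorem IsExponentRatio.nonneg {a : ℝ} {q r : ℝ≥0∞} (h : IsExponentRatio a q r) : 0 ≤ a := by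
  rcases h with ⟨h, -⟩ | ⟨rfl, -⟩
  exacts [h.le, le_rfl]

/-- With $a=p_\theta/p_0$ and $b=p_\theta/p_1$ the identity is the definition of $p_\theta$. If both
exponents are infinite, $a=b=1$ works. -/
theorem exists_isExponentRatio {θ : ℝ} (hθ : θ ∈ Set.Ioo (0 : ℝ) 1) {p₀ p₁ : ℝ≥0∞} (hp₀ : p₀ ≠ 0)
    (hp₁ : p₁ ≠ 0) : ∃ a b : ℝ, (1 - θ) * a + θ * b = 1 ∧
      IsExponentRatio a p₀ (interpExponent θ p₀ p₁) ∧
      IsExponentRatio b p₁ (interpExponent θ p₀ p₁) := by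
  have hθ' : 0 < 1 - θ := sub_pos.2 hθ.2
  by_cases htop : p₀ = ∞ ∧ p₁ = ∞
  · obtain ⟨rfl, rfl⟩ := htop
    exact ⟨1, 1, by ring, by simp [IsExponentRatio, interpExponent],
      by simp [IsExponentRatio, interpExponent]⟩
  set x := (p₀⁻¹).toReal
  set y := (p₁⁻¹).toReal
  have hx : p₀⁻¹ = ENNReal.ofReal x := (ENNReal.ofReal_toReal (ENNReal.inv_ne_top.2 hp₀)).symm
  have hy : p₁⁻¹ = ENNReal.ofReal y := (ENNReal.ofReal_toReal (ENNReal.inv_ne_top.2 hp₁)).symm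
  have hx0 : 0 ≤ x := ENNReal.toReal_nonneg
  have hy0 : 0 ≤ y := ENNReal.toReal_nonneg
  have hxpos : p₀ ≠ ∞ → 0 < x := fun h =>
    ENNReal.toReal_pos (ENNReal.inv_ne_zero.2 h) (ENNReal.inv_ne_top.2 hp₀)
  have hypos : p₁ ≠ ∞ → 0 < y := fun h =>
    ENNReal.toReal_pos (ENNReal.inv_ne_zero.2 h) (ENNReal.inv_ne_top.2 hp₁)
  set ρ := (1 - θ) * x + θ * y with hρ
  have hρ0 : 0 < ρ := by
    by_cases h : p₀ = ∞
    · exact add_pos_of_nonneg_of_pos (mul_nonneg hθ'.le hx0)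
        (mul_pos hθ.1 (hypos fun h' => htop ⟨h, h'⟩))
    · exact add_pos_of_pos_of_nonneg (mul_pos hθ' (hxpos h)) (mul_nonneg hθ.1.le hy0)
  have hr : interpExponent θ p₀ p₁ = ENNReal.ofReal ρ⁻¹ := by
    rw [interpExponent, div_eq_mul_inv, div_eq_mul_inv, hx, hy, ← ENNReal.ofReal_mul hθ'.le,
      ← ENNReal.ofReal_mul hθ.1.le, ← ENNReal.ofReal_add (mul_nonneg hθ'.le hx0)
      (mul_nonneg hθ.1.le hy0), ← ENNReal.ofReal_inv_of_pos hρ0]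
  have main : ∀ (q : ℝ≥0∞) (z : ℝ), q ≠ 0 → q⁻¹ = ENNReal.ofReal z → 0 ≤ z → (q ≠ ∞ → 0 < z) →
      IsExponentRatio (z / ρ) q (ENNReal.ofReal ρ⁻¹) := by
    intro q z hq hz hz0 hzpos
    by_cases h : q = ∞
    · refine Or.inr ⟨?_, h⟩
      rw [h, ENNReal.inv_top, eq_comm, ENNReal.ofReal_eq_zero] at hz
      rw [le_antisymm hz hz0, zero_div]
    · refine Or.inl ⟨div_pos (hzpos h) hρ0, ?_⟩
      rw [div_eq_mul_inv, ENNReal.ofReal_mul hz0, ← hz, ← mul_assoc, ENNReal.mul_inv_cancel hq h,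
        one_mul]
  refine ⟨x / ρ, y / ρ, ?_, ?_, ?_⟩
  · field_simp; rw [hρ]
  · rw [hr]; exact main _ _ hp₀ hx hx0 hxpos
  · rw [hr]; exact main _ _ hp₁ hy hy0 hypos

/-- The set where `1 / (k + 1) ≤ |h| ≤ k + 1`. -/
def levelBand (h : Lp 𝕜 p μ) (k : ℕ) : Set Ω :=
  {ω | ((k : ℝ) + 1)⁻¹ ≤ ‖h ω‖ ∧ ‖h ω‖ ≤ k + 1}

theorem measurableSet_levelBand (h : Lp 𝕜 p μ) (k : ℕ) : MeasurableSet (levelBand h k) :=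
  (measurableSet_le measurable_const (Lp.stronglyMeasurable h).norm.measurable).inter
    (measurableSet_le (Lp.stronglyMeasurable h).norm.measurable measurable_const)

theorem levelBand_mono (h : Lp 𝕜 p μ) : Monotone (levelBand h) := fun m n hmn ω hω => by
  have : (m : ℝ) ≤ n := by exact_mod_cast hmn
  exact ⟨(inv_anti₀ (by positivity) (by linarith)).trans hω.1, hω.2.trans (by linarith)⟩

theorem eventually_mem_levelBand (h : Lp 𝕜 p μ) {ω : Ω} (hω : h ω ≠ 0) :
    ∀ᶠ k in atTop, ω ∈ levelBand h k := by
  have h1 : 0 < ‖h ω‖ := norm_pos_iff.2 hω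
  obtain ⟨n, hn⟩ := exists_nat_gt (max ‖h ω‖ ‖h ω‖⁻¹)
  filter_upwards [eventually_ge_atTop n] with k hk
  have hk' : (n : ℝ) ≤ k := by exact_mod_cast hk
  have h2 := (le_max_left _ _).trans_lt hn
  have h3 := (le_max_right _ _).trans_lt hn
  exact ⟨inv_le_of_inv_le₀ h1 (by linarith), by linarith⟩

/-- The function `1_{1/(k+1) ≤ |h| ≤ k+1} |h| ^ a`. -/
def bandPower (h : Lp 𝕜 p μ) (k : ℕ) (a : ℝ) : Ω → ℝ :=
  (levelBand h k).indicator fun ω => ‖h ω‖ ^ a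

theorem bandPower_nonneg (h : Lp 𝕜 p μ) (k : ℕ) (a : ℝ) (ω : Ω) : 0 ≤ bandPower h k a ω :=
  Set.indicator_nonneg (fun _ _ => Real.rpow_nonneg (norm_nonneg _) _) _

theorem bandPower_le (h : Lp 𝕜 p μ) (k : ℕ) (a : ℝ) (ω : Ω) : bandPower h k a ω ≤ ‖h ω‖ ^ a :=
  Set.indicator_le_self' (fun _ _ => Real.rpow_nonneg (norm_nonneg _) _) _

theorem measurable_bandPower (h : Lp 𝕜 p μ) (k : ℕ) (a : ℝ) : Measurable (bandPower h k a) :=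
  ((Lp.stronglyMeasurable h).norm.measurable.pow_const a).indicator (measurableSet_levelBand h k)

/-- On the band $|h|^a\le(k+1)^a\le(k+1)^{a+1}|h|$: the upper cut-off gives the first bound, the
lower one the second. -/
theorem memLp_bandPower (h : Lp 𝕜 p μ) (k : ℕ) {a : ℝ} (ha : 0 ≤ a) :
    MemLp (bandPower h k a) p μ := by
  refine MemLp.of_le_mul (c := ((k : ℝ) + 1) ^ a * (k + 1)) (Lp.memLp h)
    (measurable_bandPower h k a).aestronglyMeasurable (Eventually.of_forall fun ω => ?_)
  rw [Real.norm_of_nonneg (bandPower_nonneg h k a ω)]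
  by_cases hω : ω ∈ levelBand h k
  · rw [bandPower, Set.indicator_of_mem hω]
    have h1 : 1 ≤ ((k : ℝ) + 1) * ‖h ω‖ := by
      have := mul_le_mul_of_nonneg_left hω.1 (by positivity : (0 : ℝ) ≤ k + 1)
      rwa [mul_inv_cancel₀ (by positivity)] at this
    calc ‖h ω‖ ^ a ≤ ((k : ℝ) + 1) ^ a := Real.rpow_le_rpow (norm_nonneg _) hω.2 ha
      _ ≤ ((k : ℝ) + 1) ^ a * (((k : ℝ) + 1) * ‖h ω‖) :=
          le_mul_of_one_le_right (by positivity) h1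
      _ = _ := by ring
  · rw [bandPower, Set.indicator_of_notMem hω]; positivity

/-- Uses $\||h|^a\|_q=\|h\|_{qa}^a$; for $a=0$, $q=\infty$ the function is an indicator. -/
theorem eLpNorm_bandPower_le_one (h : Lp 𝕜 p μ) (k : ℕ) {a : ℝ} {q r : ℝ≥0∞}
    (ha : IsExponentRatio a q r) (hr : eLpNorm h r μ ≤ 1) : eLpNorm (bandPower h k a) q μ ≤ 1 := by
  have hle : ∀ ω, ‖bandPower h k a ω‖ ≤ ‖h ω‖ ^ a := fun ω => by
    rw [Real.norm_of_nonneg (bandPower_nonneg h k a ω)]; exact bandPower_le h k a ω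
  rcases ha with ⟨ha, rfl⟩ | ⟨rfl, rfl⟩
  · refine (eLpNorm_mono_real hle).trans ?_
    rw [eLpNorm_norm_rpow _ ha]
    exact ENNReal.rpow_le_one hr ha.le
  · rw [eLpNorm_exponent_top]
    refine (eLpNormEssSup_le_of_ae_bound (C := 1) (Eventually.of_forall fun ω => ?_)).trans (by simp)
    simpa using hle ω

theorem eLpNorm_lpOfReal {φ : Ω → ℝ} (h : MemLp φ p μ) (q : ℝ≥0∞) :
    eLpNorm (lpOfReal (𝕜 := 𝕜) φ h) q μ = eLpNorm φ q μ := by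
  refine eLpNorm_congr_norm_ae ?_
  filter_upwards [coeFn_lpOfReal (𝕜 := 𝕜) h] with ω hω
  rw [hω, RCLike.norm_ofReal, Real.norm_eq_abs]

theorem tendsto_lpOfReal_bandPower_one (hp : p ≠ ∞) {h : Lp 𝕜 p μ} (hh : 0 ≤ h) :
    Tendsto (fun k => lpOfReal (𝕜 := 𝕜) _ (memLp_bandPower h k zero_le_one)) atTop (𝓝 h) := by
  set u : ℕ → Lp 𝕜 p μ := fun k => lpOfReal (𝕜 := 𝕜) _ (memLp_bandPower h k zero_le_one)
  have hu : ∀ k, u k =ᵐ[μ] fun ω => ((bandPower h k 1 ω : ℝ) : 𝕜) := fun k => coeFn_lpOfReal _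
  have hmono : Monotone u := fun m n hmn => by
    rw [← Lp.coeFn_le]
    filter_upwards [hu m, hu n] with ω h1 h2
    rw [h1, h2, RCLike.ofReal_le_ofReal]
    exact Set.indicator_le_indicator_of_subset (levelBand_mono h hmn)
      (fun _ => Real.rpow_nonneg (norm_nonneg _) _) ω
  obtain ⟨x, hx⟩ := lp_exists_tendsto_of_monotone hp hmono (g := h) fun k =>
    lpOfReal_le _ hh (Eventually.of_forall fun ω => by simpa using bandPower_le h k 1 ω)
  obtain ⟨ns, hns, hae⟩ := lp_exists_subseq_ae_tendsto hx
  have : x = h := by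
    refine Lp.ext ?_
    filter_upwards [hae, ae_all_iff.2 hu, lp_ae_nonneg hh] with ω h1 h2 h3
    refine tendsto_nhds_unique h1 ?_
    simp only [h2]
    by_cases h0 : h ω = 0
    · have : ∀ k, bandPower h k 1 ω = 0 := fun k => by simp [bandPower, h0]
      simp only [this, h0, RCLike.ofReal_zero]
      exact tendsto_const_nhds
    · refine tendsto_const_nhds.congr' ?_
      filter_upwards [hns.tendsto_atTop.eventually (eventually_mem_levelBand h h0)] with k hk
      rw [bandPower, Set.indicator_of_mem hk, Real.rpow_one, RCLike.norm_of_nonneg' h3]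
  rwa [this] at hx

theorem geomMeanLE_bandPower {θ a b : ℝ} (hθ : θ ∈ Set.Ioo (0 : ℝ) 1)
    (hab : (1 - θ) * a + θ * b = 1) (h : Lp 𝕜 p μ) (k : ℕ)
    (ha : 0 ≤ a) (hb : 0 ≤ b) :
    GeomMeanLE θ (lpOfReal (𝕜 := 𝕜) _ (memLp_bandPower h k zero_le_one))
      (lpOfReal _ (memLp_bandPower h k ha)) (lpOfReal _ (memLp_bandPower h k hb)) := by
  filter_upwards [coeFn_lpOfReal (𝕜 := 𝕜) (memLp_bandPower h k zero_le_one),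
    coeFn_lpOfReal (𝕜 := 𝕜) (memLp_bandPower h k ha),
    coeFn_lpOfReal (𝕜 := 𝕜) (memLp_bandPower h k hb)] with ω h1 h2 h3
  simp only [h1, h2, h3, RCLike.norm_ofReal, abs_of_nonneg (bandPower_nonneg _ _ _ _)]
  by_cases hω : ω ∈ levelBand h k
  · simp only [bandPower, Set.indicator_of_mem hω]
    have hpos : 0 < ‖h ω‖ := lt_of_lt_of_le (by positivity) hω.1
    rw [← Real.rpow_mul hpos.le, ← Real.rpow_mul hpos.le, ← Real.rpow_add hpos, mul_comm a,
      mul_comm b, hab]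
  · simp only [bandPower, Set.indicator_of_notMem hω]
    rw [Real.zero_rpow (sub_pos.2 hθ.2).ne', zero_mul]

/-- Interpolation of `L_p`-`L_q` bounds for positive operators that satisfy a Hölder-type
inequality. -/
theorem opNormLp_le_of_geomMeanLE (hp : p ≠ ∞) {θ : ℝ} (hθ : θ ∈ Set.Ioo (0 : ℝ) 1)
    {B B₀ B₁ : Lp 𝕜 p μ →L[𝕜] Lp 𝕜 p μ} (hB : IsPositiveLpOperator B)
    (hle : ∀ h f g, 0 ≤ h → 0 ≤ f → 0 ≤ g → GeomMeanLE θ h f g → GeomMeanLE θ (B h) (B₀ f) (B₁ g))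
    {p₀ p₁ q₀ q₁ : ℝ≥0∞} (hp₀ : p₀ ≠ 0) (hp₁ : p₁ ≠ 0) :
    opNormLp B (interpExponent θ p₀ p₁) (interpExponent θ q₀ q₁) ≤
      opNormLp B₀ p₀ q₀ ^ (1 - θ) * opNormLp B₁ p₁ q₁ ^ θ := by
  refine iSup₂_le fun f₀ hf₀ => ?_
  obtain ⟨a, b, hab, ha, hb⟩ := exists_isExponentRatio hθ hp₀ hp₁
  have hn : MemLp (fun ω => ‖f₀ ω‖) p μ := (Lp.memLp f₀).norm
  set h : Lp 𝕜 p μ := lpOfReal _ hn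
  have hh : 0 ≤ h := lpOfReal_nonneg _ fun _ => norm_nonneg _
  have hnorm : ∀ᵐ ω ∂μ, ‖f₀ ω‖ = ‖h ω‖ := by
    filter_upwards [coeFn_lpOfReal (𝕜 := 𝕜) hn] with ω hω
    rw [hω, RCLike.norm_ofReal, abs_norm]
  have hh1 : eLpNorm h (interpExponent θ p₀ p₁) μ ≤ 1 := by
    rwa [← eLpNorm_congr_norm_ae hnorm]
  -- Reduction to the nonnegative function $h=|f_0|$.
  refine (eLpNorm_mono_ae (hB.norm_apply_le hh (hnorm.mono fun _ => le_of_eq))).trans ?_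
  have hlim := (B.continuous.tendsto h).comp (tendsto_lpOfReal_bandPower_one hp hh)
  obtain ⟨ns, -, hae⟩ := lp_exists_subseq_ae_tendsto hlim
  -- The images converge only in $L_p$, so Fatou's lemma along an a.e. convergent subsequence
  -- carries the bound to the target norm.
  refine (Lp.eLpNorm_lim_le_liminf_eLpNorm (fun i => Lp.aestronglyMeasurable _) _ hae).trans ?_
  refine liminf_le_of_frequently_le' (Frequently.of_forall fun i => ?_)
  set k := ns i
  refine (eLpNorm_le_of_geomMeanLE hθ (hle _ _ _
    (lpOfReal_nonneg _ fun _ => bandPower_nonneg _ _ _ _)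
    (lpOfReal_nonneg _ fun _ => bandPower_nonneg _ _ _ _)
    (lpOfReal_nonneg _ fun _ => bandPower_nonneg _ _ _ _)
    (geomMeanLE_bandPower hθ hab h k ha.nonneg hb.nonneg)) q₀ q₁).trans ?_
  refine mul_le_mul' (ENNReal.rpow_le_rpow ?_ (sub_pos.2 hθ.2).le)
    (ENNReal.rpow_le_rpow ?_ hθ.1.le)
  · exact le_iSup₂_of_le (lpOfReal _ (memLp_bandPower h k ha.nonneg))
      (by rw [eLpNorm_lpOfReal]; exact eLpNorm_bandPower_le_one h k ha hh1) le_rfl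
  · exact le_iSup₂_of_le (lpOfReal _ (memLp_bandPower h k hb.nonneg))
      (by rw [eLpNorm_lpOfReal]; exact eLpNorm_bandPower_le_one h k hb hh1) le_rfl

end Interpolation

end

theorem mainTheorem6 {Ω 𝕜 : Type*} [MeasurableSpace Ω] [RCLike 𝕜] (μ : Measure Ω)
    (p : ℝ≥0∞) [Fact (1 ≤ p)] (hp_one : 1 < p) (hp_top : p < ∞)
    (T : ℝ≥0 → Lp 𝕜 p μ →L[𝕜] Lp 𝕜 p μ) (hT : IsC0Semigroup T)
    (hTpos : ∀ t, IsPositiveLpOperator (T t))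
    (V : Ω → ℝ) (hV : IsAdmissible T V)
    (t : ℝ≥0) (ht : 0 < t)
    (p₀ p₁ q₀ q₁ : ℝ≥0∞) (hp₀ : 1 ≤ p₀) (hp₁ : 1 ≤ p₁) (hq₀ : 1 ≤ q₀) (hq₁ : 1 ≤ q₁)
    (hfin₀ : opNormLp (T t) p₀ q₀ < ∞)
    (hfin₁ : opNormLp (perturbedSemigroup T V t) p₁ q₁ < ∞)
    (θ : ℝ) (hθ : θ ∈ Set.Ioo (0 : ℝ) 1) :
    IsAdmissible T (fun ω => θ * V ω) ∧
    StronglyTendsto (truncatedPerturbation T fun ω => θ * V ω)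
      (perturbedSemigroup T fun ω => θ * V ω) ∧
    opNormLp (perturbedSemigroup T (fun ω => θ * V ω) t)
        (interpExponent θ p₀ p₁) (interpExponent θ q₀ q₁) ≤
      opNormLp (T t) p₀ q₀ ^ (1 - θ) * opNormLp (perturbedSemigroup T V t) p₁ q₁ ^ θ := by
  have hp : p ≠ ∞ := hp_top.ne
  have hVθ := hV.const_mul hp hT hTpos hθ.1.le hθ.2.le
  refine ⟨hVθ, hVθ.stronglyTendsto hp hT hTpos, ?_⟩
  exact opNormLp_le_of_geomMeanLE hp hθ (hVθ.isPositiveLpOperator hp hT hTpos t)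
    (fun h f g hh hf hg hle => hle.perturbedSemigroup hp hT hTpos hV hθ hh hf hg t)
    (zero_lt_one.trans_le hp₀).ne' (zero_lt_one.trans_le hp₁).ne'
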